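/- **Conventions.** For a relation $R$ on a set $X$ and $A\subseteq X$ put $\neg^+A=\{x:\forall x'\,(x'Rx\Rightarrow x'\notin A)\}$ and $\neg^-A=\{x:\forall x'\,(xRx'\Rightarrow x'\notin A)\}$. Write $x\le^+ y$ if $\forall z\,(zRx\Rightarrow zRy)$, and $x\le^- y$ if $\forall z\,(xRz\Rightarrow yRz)$. A *fundamental frame* is a (possibly empty) set $X$ with a relation $R$ such that: every $x$ has some $x'Rx$; every $x$ has some $yRx$ with $y\le^+x$; and whenever $xRx'$ there is $yRx$ with $y\le^+x'$. An *AUFM frame* $(X,R,M)$ is a fundamental frame with a relation $M$ such that for all $x,y,z$: - if $xMy$ and $zRy$, then $\exists x'Rx\ \forall y'\,(x'Ry'\Rightarrow\exists z'\,(y'Mz'\wedge zRz'))$; - if $xMy$ and $yRz$, then $\exists x'\,(xRx'\wedge\forall y'\,(y'Rx'\Rightarrow\exists z'\,(y'Mz'\wedge z'Rz)))$. A *fundamental modal lattice* is a bounded lattice with unary operations $\neg,\Box,\Diamond$ such that $a\le\neg b\iff b\le\neg a$, $a\wedge\neg a=0$, $\Box(a\wedge b)=\Box a\wedge\Box b$,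 $\Box1=1$, $\Diamond(a\vee b)=\Diamond a\vee\Diamond b$, $\Diamond0=0$, $\Diamond\neg a\le\neg\Box a$. The *positive algebra* of $(X,R,M)$ is the lattice of all $A\subseteq X$ with $\neg^+\neg^-A=A$, ordered by inclusion (meets are intersections, $A\vee B=\neg^+\neg^-(A\cup B)$), with negation $\neg^+$, $\Box_MA=\{x:\forall y\,(xMy\Rightarrow y\in A)\}$ and $\Diamond_MA=\neg^+\Box_M\neg^-A$; it is a fundamental modal lattice. The *canonical frame* of a fundamental modal lattice $L$ is the AUFM frame whose points are the pairs $(F,I)$ with $F$ a proper filter of $L$, $I$ an ideal of $L$ (possibly improper) and $\neg a\in I$ for all $a\in F$, where $(F,I)R(G,J)$ iff $I\cap G=\emptyset$, and $(F,I)M(G,J)$ iff ($\Box a\in F\Rightarrow a\in G$ and $\Diamond a\in I\Rightarrow a\in J$, for all $a$). The *filter extension* of an AUFM frame is the canonical frame of its positive algebra. The *coproduct* of a set-indexed (possibly empty) family of AUFM frames is its disjoint union. An *AUFM-morphism* $h:(X,R,M)\to(Y,S,N)$ is a map such that, for all $x,x'\in X$ and $y\in Y$ (with $\le^\pm$ taken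 in $Y$): $xRx'\Rightarrow h(x)Sh(x')$; if $h(x)Sy$ then $\exists x'$ with $xRx'$ and $h(x')\le^+y$; if $ySh(x)$ then $\exists x',x''$ with $x'Rx$, $x''Rx$, $h(x')\le^-y$, $h(x'')\le^+y$; $xMx'\Rightarrow h(x)Nh(x')$; if $h(x)Ny$ then $\exists x'$ with $xMx'$, $y\le^+h(x')$ and $y\le^-h(x')$. It is *dense* if $y'Sy$ implies $\exists x$ with $h(x)\le^+y$ and $y'Sh(x)$; *strongly dense* if for every $y$ there is $x$ with $h(x)\le^+y$ and $y\le^+h(x)$; an *embedding* if $h(x)Sh(x')$ implies $\exists z$ with $xRz$ and $z\le^+x'$; a *strong embedding* if $h(x)Sh(x')$ implies $xRx'$. $X$ is a (*strong*) *modal subframe* of $Y$ if there is an AUFM-morphism $X\to Y$ that is a (strong) embedding, and a *dense* (*strongly dense*) *modal image* of $Y$ if there is a dense (strongly dense) AUFM-morphism $Y\to X$. Formulas are built from countably many letters with $\bot,\top,\neg,\wedge,\vee,\Box,\Diamond$. A *superfundamental modal logic* is a reflexive and transitive relation $\vdash$ on formulas, closed under uniform substitution and under: $\bot\vdash\varphi$;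 $\varphi\vdash\top$; $\top\vdash\neg\bot$; $\varphi\wedge\psi\vdash\varphi$; $\varphi\wedge\psi\vdash\psi$; $\chi\vdash\varphi\ \&\ \chi\vdash\psi\Rightarrow\chi\vdash\varphi\wedge\psi$; $\varphi\vdash\varphi\vee\psi$; $\psi\vdash\varphi\vee\psi$; $\varphi\vdash\chi\ \&\ \psi\vdash\chi\Rightarrow\varphi\vee\psi\vdash\chi$; $\varphi\wedge\neg\varphi\vdash\bot$; $\varphi\vdash\neg\neg\varphi$; $\varphi\vdash\psi\Rightarrow\neg\psi\vdash\neg\varphi$; $\varphi\vdash\psi\Rightarrow\Box\varphi\vdash\Box\psi$; $\Box\varphi\wedge\Box\psi\vdash\Box(\varphi\wedge\psi)$; $\top\vdash\Box\top$; $\varphi\vdash\psi\Rightarrow\Diamond\varphi\vdash\Diamond\psi$; $\Diamond(\varphi\vee\psi)\vdash\Diamond\varphi\vee\Diamond\psi$; $\Diamond\bot\vdash\bot$; $\Diamond\neg\varphi\vdash\neg\Box\varphi$. A fundamental modal lattice *validates* $L$ if $\varphi\vdash\psi$ in $L$ implies $V(\varphi)\le V(\psi)$ for all valuations $V$; an AUFM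 frame validates $L$ if the same holds for all valuations in its positive algebra, and $Mod(L)$ is the class of AUFM frames validating $L$. A *canonical extension* of a bounded lattice $A$ is an embedding $e$ of bounded lattices of $A$ in a complete lattice $C$ such that every element of $C$ is both a join of meets and a meet of joins of elements of $e[A]$, and such that $\bigwedge e[S]\le\bigvee e[T]$ with $S,T\subseteq A$ implies $\bigwedge S'\le\bigvee T'$ for some finite $S'\subseteq S$, $T'\subseteq T$. If $A$ is a fundamental modal lattice, the *$\pi$-canonical extension* carries the operations $\neg^\pi u=\bigwedge\{\bigvee_{a\in F}e(\neg a): F\text{ a filter of }A,\ \bigwedge e[F]\le u\}$ and, for $f\in\{\Box,\Diamond\}$, $f^\pi u=\bigwedge\{\bigvee_{a\in I}e(f a): I\text{ an ideal of }A,\ u\le\bigvee e[I]\}$. A superfundamental modal logic $L$ is *canonical* if the class of fundamental modal lattices validating $L$ is closed under $\pi$-canonical extensions. **Corollary.** Let $\mathfrak K$ be a class of AUFM frames. The following are equivalent: 1. $\mathfrak K=Mod(L)$ for some canonical superfundamental modal logic $L$; 2. $\mathfrak K$ is closed under filter extensions, modal subframes, dense modal images and coproducts, and it reflects filter extensions (if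 the filter extension of $X$ is in $\mathfrak K$, so is $X$); 3. $\mathfrak K$ is closed under filter extensions, strong modal subframes, strongly dense modal images and coproducts, and it reflects filter extensions. -/

import Mathlib

universe u v

namespace FundLogic

/-! ### Relational notions on a set with an openness relation

`R x y` is read as: `x` is open to `y`. -/

section Relational

variable {X : Type u} (R : X → X → Prop)

/-- Positive negation: `x ∈ pneg R A` iff no `x'` that is open to `x` lies in `A`. -/
def pneg (A : Set X) : Set X := {x | ∀ x', R x' x → x' ∉ A}

/-- Negative negation: `x ∈ nneg R A` iff no `x'` to which `x` is open lies in `A`. -/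
def nneg (A : Set X) : Set X := {x | ∀ x', R x x' → x' ∉ A}

/-- The closure operator: `x ∈ clo R A` iff every `y` open to `x` is open to some `z ∈ A`. -/
def clo (A : Set X) : Set X := {x | ∀ y, R y x → ∃ z, R y z ∧ z ∈ A}

/-- `x` positively refines `x'`. -/
def PosRef (x x' : X) : Prop := ∀ z, R z x → R z x'

/-- `x` negatively refines `x'`. -/
def NegRef (x x' : X) : Prop := ∀ z, R x z → R x' z

/-- The box operation of an accessibility relation. -/
def boxOp (M : X → X → Prop) (A : Set X) : Set X := {x | ∀ y, M x y → y ∈ A}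

/-- The pseudo-dual of the box operation. -/
def diaOp (M : X → X → Prop) (A : Set X) : Set X := pneg R (boxOp M (nneg R A))

theorem pneg_nneg (A : Set X) : pneg R (nneg R A) = clo R A := by
  ext x
  simp only [pneg, nneg, clo, Set.mem_ofPred_eq]
  constructor
  · intro h y hy
    have := h y hy
    push Not at this
    exact this
  · intro h y hy hn
    obtain ⟨z, hz, hzA⟩ := h y hy
    exact hn z hz hzA

theorem subset_clo (A : Set X) : A ⊆ clo R A := fun x hx _ hy => ⟨x, hy, hx⟩

theorem clo_mono {A B : Set X} (h : A ⊆ B) : clo R A ⊆ clo R B := fun _ hx y hy =>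
  let ⟨z, hz, hzA⟩ := hx y hy
  ⟨z, hz, h hzA⟩

theorem clo_pneg (A : Set X) : clo R (pneg R A) = pneg R A := by
  refine Set.Subset.antisymm (fun x hx y hy hyA => ?_) (subset_clo R _)
  obtain ⟨z, hz, hzA⟩ := hx y hy
  exact hzA y hz hyA

theorem clo_clo (A : Set X) : clo R (clo R A) = clo R A := by
  rw [← pneg_nneg R A, clo_pneg]

end Relational

/-! ### Frames -/

/-- Fundamental frames: co-serial, pseudo-reflexive and pseudo-symmetric relations. -/
structure FundFrame : Type (u + 1) where
  carrier : Type u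
  R : carrier → carrier → Prop
  coserial : ∀ x, ∃ x', R x' x
  pseudoRefl : ∀ x, ∃ y, R y x ∧ PosRef R y x
  pseudoSymm : ∀ x x', R x x' → ∃ y, R y x ∧ PosRef R y x'

/-- Additive unified fundamental modal frames. The first condition on `M` says that the box
operation of `M` preserves fixpoints of `pneg ∘ nneg`, the second one that it preserves fixpoints
of `nneg ∘ pneg`, each in first-order form. -/
structure AUFMFrame : Type (u + 1) extends FundFrame.{u} where
  M : carrier → carrier → Prop
  cond_pos : ∀ x y z, M x y → R z y →
    ∃ x', R x' x ∧ ∀ y', R x' y' → ∃ z', M y' z' ∧ R z z'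
  cond_neg : ∀ x y z, M x y → R y z →
    ∃ x', R x x' ∧ ∀ y', R y' x' → ∃ z', M y' z' ∧ R z' z

/-! ### The language, its algebraic semantics and its logics -/

/-- Formulas of fundamental modal logic. -/
inductive Form : Type
  | var (n : ℕ) : Form
  | bot : Form
  | top : Form
  | neg (φ : Form) : Form
  | and (φ ψ : Form) : Form
  | or (φ ψ : Form) : Form
  | box (φ : Form) : Form
  | dia (φ : Form) : Form

/-- Uniform substitution. -/
def Form.subst (σ : ℕ → Form) : Form → Form
  | .var n => σ n
  | .bot => .bot
  | .top => .top
  | .neg φ => .neg (φ.subst σ)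
  | .and φ ψ => .and (φ.subst σ) (ψ.subst σ)
  | .or φ ψ => .or (φ.subst σ) (ψ.subst σ)
  | .box φ => .box (φ.subst σ)
  | .dia φ => .dia (φ.subst σ)

/-- A superfundamental modal logic: a consequence relation between formulas that is closed under
the axioms and rules of fundamental modal logic (hence extends it) and under uniform
substitution. -/
structure IsSuperFundModalLogic (Λ : Form → Form → Prop) : Prop where
  refl : ∀ φ, Λ φ φ
  trans : ∀ φ ψ χ, Λ φ ψ → Λ ψ χ → Λ φ χ
  bot_le : ∀ φ, Λ .bot φ
  le_top : ∀ φ, Λ φ .top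
  top_neg_bot : Λ .top (.neg .bot)
  and_left : ∀ φ ψ, Λ (.and φ ψ) φ
  and_right : ∀ φ ψ, Λ (.and φ ψ) ψ
  and_intro : ∀ χ φ ψ, Λ χ φ → Λ χ ψ → Λ χ (.and φ ψ)
  or_left : ∀ φ ψ, Λ φ (.or φ ψ)
  or_right : ∀ φ ψ, Λ ψ (.or φ ψ)
  or_elim : ∀ φ ψ χ, Λ φ χ → Λ ψ χ → Λ (.or φ ψ) χ
  and_neg : ∀ φ, Λ (.and φ (.neg φ)) .bot
  neg_neg : ∀ φ, Λ φ (.neg (.neg φ))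
  neg_anti : ∀ φ ψ, Λ φ ψ → Λ (.neg ψ) (.neg φ)
  box_mono : ∀ φ ψ, Λ φ ψ → Λ (.box φ) (.box ψ)
  box_and : ∀ φ ψ, Λ (.and (.box φ) (.box ψ)) (.box (.and φ ψ))
  box_top : Λ .top (.box .top)
  dia_mono : ∀ φ ψ, Λ φ ψ → Λ (.dia φ) (.dia ψ)
  dia_or : ∀ φ ψ, Λ (.dia (.or φ ψ)) (.or (.dia φ) (.dia ψ))
  dia_bot : Λ (.dia .bot) .bot
  dia_neg : ∀ φ, Λ (.dia (.neg φ)) (.neg (.box φ))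
  subst : ∀ φ ψ (σ : ℕ → Form), Λ φ ψ → Λ (φ.subst σ) (ψ.subst σ)

/-- The value of a formula on an AUFM frame. -/
def AUFMFrame.val (X : AUFMFrame.{u}) (V : ℕ → Set X.carrier) : Form → Set X.carrier
  | .var n => V n
  | .bot => ∅
  | .top => Set.univ
  | .neg φ => pneg X.R (X.val V φ)
  | .and φ ψ => X.val V φ ∩ X.val V ψ
  | .or φ ψ => clo X.R (X.val V φ ∪ X.val V ψ)
  | .box φ => boxOp X.M (X.val V φ)
  | .dia φ => diaOp X.R X.M (X.val V φ)

/-- `ψ` is a consequence of `φ` on the frame `X`: valuations take values in the positive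
algebra. -/
def AUFMFrame.Conseq (X : AUFMFrame.{u}) (φ ψ : Form) : Prop :=
  ∀ V : ℕ → Set X.carrier, (∀ n, pneg X.R (nneg X.R (V n)) = V n) → X.val V φ ⊆ X.val V ψ

/-- The class of AUFM frames on which all consequences of `Λ` hold. -/
def Mod (Λ : Form → Form → Prop) : Set AUFMFrame.{u} :=
  {X | ∀ φ ψ, Λ φ ψ → X.Conseq φ ψ}

/-- Three unary operations, interpreting negation, box and diamond. -/
structure Ops (L : Type u) : Type u where
  neg : L → L
  box : L → L
  dia : L → L

/-- The bounded lattice `L` with the operations `o` is a fundamental modal lattice. -/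
structure Ops.IsFundModal {L : Type u} [Lattice L] [BoundedOrder L] (o : Ops L) : Prop where
  neg_adj : ∀ a b, a ≤ o.neg b ↔ b ≤ o.neg a
  inf_neg : ∀ a, a ⊓ o.neg a = ⊥
  box_inf : ∀ a b, o.box (a ⊓ b) = o.box a ⊓ o.box b
  box_top : o.box ⊤ = ⊤
  dia_sup : ∀ a b, o.dia (a ⊔ b) = o.dia a ⊔ o.dia b
  dia_bot : o.dia ⊥ = ⊥
  dia_neg : ∀ a, o.dia (o.neg a) ≤ o.neg (o.box a)

/-- The value of a formula in a bounded lattice with operations. -/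
def Ops.eval {L : Type u} [Lattice L] [BoundedOrder L] (o : Ops L) (V : ℕ → L) : Form → L
  | .var n => V n
  | .bot => ⊥
  | .top => ⊤
  | .neg φ => o.neg (o.eval V φ)
  | .and φ ψ => o.eval V φ ⊓ o.eval V ψ
  | .or φ ψ => o.eval V φ ⊔ o.eval V ψ
  | .box φ => o.box (o.eval V φ)
  | .dia φ => o.dia (o.eval V φ)

/-- Membership in the variety of fundamental modal lattices corresponding to `Λ`. -/
def Ops.InVariety {L : Type u} [Lattice L] [BoundedOrder L] (o : Ops L)
    (Λ : Form → Form → Prop) : Prop :=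
  o.IsFundModal ∧ ∀ φ ψ, Λ φ ψ → ∀ V : ℕ → L, o.eval V φ ≤ o.eval V ψ

/-! ### Canonical extensions -/

/-- The embedding `e` of a bounded lattice `L` in a complete lattice `C` makes `C` a canonical
extension of `L`: every element of `C` is a join of meets and a meet of joins of elements of `L`,
and `L` sits compactly in `C`. -/
structure IsCanonicalExtension {L : Type u} {C : Type v} [Lattice L] [BoundedOrder L]
    [CompleteLattice C] (e : BoundedLatticeHom L C) : Prop where
  injective : Function.Injective e
  join_meets : ∀ c : C, ∃ S : Set (Set L), c = ⨆ J ∈ S, ⨅ a ∈ J, e a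
  meet_joins : ∀ c : C, ∃ S : Set (Set L), c = ⨅ J ∈ S, ⨆ a ∈ J, e a
  compact : ∀ S T : Set L, ⨅ a ∈ S, e a ≤ ⨆ b ∈ T, e b →
    ∃ S' T' : Finset L, (S' : Set L) ⊆ S ∧ (T' : Set L) ⊆ T ∧ S'.inf id ≤ T'.sup id

/-- The `π`-extension of an antitone operation. -/
def piAnti {L : Type u} {C : Type v} [Lattice L] [BoundedOrder L] [CompleteLattice C]
    (e : BoundedLatticeHom L C) (f : L → L) (c : C) : C :=
  sInf {d | ∃ F : Order.PFilter L, ⨅ a ∈ F, e a ≤ c ∧ d = ⨆ a ∈ F, e (f a)}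

/-- The `π`-extension of a monotone operation. -/
def piMono {L : Type u} {C : Type v} [Lattice L] [BoundedOrder L] [CompleteLattice C]
    (e : BoundedLatticeHom L C) (f : L → L) (c : C) : C :=
  sInf {d | ∃ I : Order.Ideal L, c ≤ ⨆ a ∈ I, e a ∧ d = ⨆ a ∈ I, e (f a)}

/-- The operations of the `π`-canonical extension. -/
def Ops.piExt {L : Type u} {C : Type v} [Lattice L] [BoundedOrder L] [CompleteLattice C]
    (o : Ops L) (e : BoundedLatticeHom L C) : Ops C where
  neg := piAnti e o.neg
  box := piMono e o.box
  dia := piMono e o.dia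

/-- `Λ` is canonical: the variety of fundamental modal lattices corresponding to `Λ` is closed
under `π`-canonical extensions. -/
def IsCanonicalLogic (Λ : Form → Form → Prop) : Prop :=
  ∀ (L : Type u) [Lattice L] [BoundedOrder L] (o : Ops L), o.InVariety Λ →
    ∀ (C : Type u) [CompleteLattice C] (e : BoundedLatticeHom L C), IsCanonicalExtension e →
      (o.piExt e).InVariety Λ

/-! ### The positive algebra of a frame -/

/-- The positive algebra of a fundamental frame: the fixpoints of `pneg ∘ nneg`. -/
def PosAlg (X : FundFrame.{u}) : Type u := {A : Set X.carrier // pneg X.R (nneg X.R A) = A}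

namespace PosAlg

variable {X : FundFrame.{u}}

theorem clo_eq (A : PosAlg X) : clo X.R A.1 = A.1 := by rw [← pneg_nneg]; exact A.2

/-- Build an element of the positive algebra from a closed set. -/
def mk (A : Set X.carrier) (h : clo X.R A = A) : PosAlg X := ⟨A, by rw [pneg_nneg]; exact h⟩

theorem clo_empty : clo X.R (∅ : Set X.carrier) = ∅ := by
  ext x
  simp only [Set.mem_empty_iff_false, iff_false]
  intro hx
  obtain ⟨x', hx'⟩ := X.coserial x
  obtain ⟨z, _, hz⟩ := hx x' hx'
  exact hz

instance : PartialOrder (PosAlg X) := Subtype.partialOrder _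

/-- The lattice structure: meets are intersections, joins are closures of unions. -/
instance : Lattice (PosAlg X) where
  sup A B := mk (clo X.R (A.1 ∪ B.1)) (clo_clo _ _)
  le_sup_left A B := Set.Subset.trans Set.subset_union_left (subset_clo X.R (A.1 ∪ B.1))
  le_sup_right A B := Set.Subset.trans Set.subset_union_right (subset_clo X.R (A.1 ∪ B.1))
  sup_le A B C hA hB := by
    have h : clo X.R (A.1 ∪ B.1) ⊆ clo X.R C.1 := clo_mono _ (Set.union_subset hA hB)
    rw [clo_eq] at h
    exact h
  inf A B := mk (A.1 ∩ B.1) (Set.Subset.antisymm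
    (Set.subset_inter
      (by have h := clo_mono X.R (A := A.1 ∩ B.1) Set.inter_subset_left
          rwa [clo_eq A] at h)
      (by have h := clo_mono X.R (A := A.1 ∩ B.1) Set.inter_subset_right
          rwa [clo_eq B] at h)) (subset_clo _ _))
  inf_le_left A B := Set.inter_subset_left (s := A.1) (t := B.1)
  inf_le_right A B := Set.inter_subset_right (s := A.1) (t := B.1)
  le_inf A B C h1 h2 := Set.subset_inter (r := A.1) h1 h2

instance : BoundedOrder (PosAlg X) where
  top := mk Set.univ (Set.Subset.antisymm (Set.subset_univ _) (subset_clo _ _))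
  le_top A := Set.subset_univ A.1
  bot := mk ∅ clo_empty
  bot_le A := Set.empty_subset A.1

end PosAlg

namespace AUFMFrame

variable (X : AUFMFrame.{u})

theorem clo_boxOp (A : Set X.carrier) (h : clo X.R A = A) :
    clo X.R (boxOp X.M A) = boxOp X.M A := by
  refine Set.Subset.antisymm (fun x hx y hxy => ?_) (subset_clo _ _)
  rw [← h]
  intro z hz
  obtain ⟨x', hx', hall⟩ := X.cond_pos x y z hxy hz
  obtain ⟨y', hy', hbox⟩ := hx x' hx'
  obtain ⟨z', hz', hzz'⟩ := hall y' hy'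
  exact ⟨z', hzz', hbox z' hz'⟩

theorem nneg_pneg_boxOp_nneg (A : Set X.carrier) :
    nneg X.R (pneg X.R (boxOp X.M (nneg X.R A))) = boxOp X.M (nneg X.R A) := by
  refine Set.Subset.antisymm (fun x hx y hxy z hyz hzA => ?_) (fun x hx y hxy hy => hy x hxy hx)
  obtain ⟨x', hx', hall⟩ := X.cond_neg x y z hxy hyz
  refine hx x' hx' (fun y' hy' hbox => ?_)
  obtain ⟨z', hz', hzz'⟩ := hall y' hy'
  exact hbox z' hz' z hzz' hzA

/-- The operations of the positive algebra of an AUFM frame. -/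
def posOps : Ops (PosAlg X.toFundFrame) where
  neg A := PosAlg.mk (pneg X.R A.1) (clo_pneg _ _)
  box A := PosAlg.mk (boxOp X.M A.1) (X.clo_boxOp A.1 A.clo_eq)
  dia A := PosAlg.mk (diaOp X.R X.M A.1) (clo_pneg _ _)

theorem posOps_isFundModal : X.posOps.IsFundModal where
  neg_adj := by
    have key : ∀ A B : PosAlg X.toFundFrame, A ≤ X.posOps.neg B → B ≤ X.posOps.neg A := by
      intro A B h x hxB y hyx hyA
      obtain ⟨w, hwy, hwx⟩ := X.pseudoSymm y x hyx
      have hw : w ∈ B.1 := by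
        rw [← B.clo_eq]
        intro z hz
        exact ⟨x, hwx z hz, hxB⟩
      exact h hyA w hwy hw
    exact fun A B => ⟨key A B, key B A⟩
  inf_neg A := by
    refine le_antisymm (fun x hx => ?_) bot_le
    obtain ⟨w, hwx, hw⟩ := X.pseudoRefl x
    refine (hx.2 w hwx ?_).elim
    rw [← A.clo_eq]
    exact fun z hz => ⟨x, hw z hz, hx.1⟩
  box_inf A B := by
    refine Subtype.ext (Set.ext fun x => ?_)
    exact ⟨fun h => ⟨fun y hy => (h y hy).1, fun y hy => (h y hy).2⟩,
      fun h y hy => ⟨h.1 y hy, h.2 y hy⟩⟩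
  box_top := Subtype.ext (Set.ext fun _ => ⟨fun _ => trivial, fun _ _ _ => trivial⟩)
  dia_sup A B := by
    apply Subtype.ext
    change pneg X.R (boxOp X.M (nneg X.R (clo X.R (A.1 ∪ B.1)))) =
      clo X.R (pneg X.R (boxOp X.M (nneg X.R A.1)) ∪ pneg X.R (boxOp X.M (nneg X.R B.1)))
    rw [← pneg_nneg X.R (_ ∪ pneg X.R _)]
    congr 1
    have h1 : nneg X.R (clo X.R (A.1 ∪ B.1)) = nneg X.R A.1 ∩ nneg X.R B.1 := by
      ext x
      constructor
      · intro h
        exact ⟨fun y hy hyA => h y hy (subset_clo _ _ (Or.inl hyA)),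
          fun y hy hyB => h y hy (subset_clo _ _ (Or.inr hyB))⟩
      · rintro ⟨hA, hB⟩ y hy hyC
        obtain ⟨z, hz, hzA | hzB⟩ := hyC x hy
        · exact hA z hz hzA
        · exact hB z hz hzB
    have h2 : ∀ P Q : Set X.carrier, nneg X.R (P ∪ Q) = nneg X.R P ∩ nneg X.R Q := by
      intro P Q
      ext x
      exact ⟨fun h => ⟨fun y hy hP => h y hy (Or.inl hP), fun y hy hQ => h y hy (Or.inr hQ)⟩,
        fun h y hy hPQ => hPQ.elim (h.1 y hy) (h.2 y hy)⟩
    rw [h1, h2, nneg_pneg_boxOp_nneg, nneg_pneg_boxOp_nneg]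
    ext x
    exact ⟨fun h => ⟨fun y hy => (h y hy).1, fun y hy => (h y hy).2⟩,
      fun h y hy => ⟨h.1 y hy, h.2 y hy⟩⟩
  dia_bot := by
    refine le_antisymm (fun x hx => ?_) bot_le
    obtain ⟨y, hy⟩ := X.coserial x
    exact (hx y hy (fun z _ w _ hw => hw)).elim
  dia_neg A := fun x hx y hy hyA => hx y hy (fun z hz w hw hwA => hwA z hw (hyA z hz))

end AUFMFrame

/-! ### Canonical frames and filter extensions -/

/-- Points of the canonical frame: a proper filter and an ideal such that the negations of the
elements of the filter lie in the ideal. -/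
structure CanPoint {L : Type u} [Lattice L] [BoundedOrder L] (o : Ops L) : Type u where
  F : Order.PFilter L
  I : Order.Ideal L
  proper : ⊥ ∉ F
  neg_mem : ∀ a ∈ F, o.neg a ∈ I

section Canonical

variable {L : Type u} [Lattice L] [BoundedOrder L]

/-- The filter of all `c` above some `f a`, `a` in the filter `F`, for monotone `f`. -/
def upFilter (F : Order.PFilter L) (f : L → L) (hf : Monotone f) : Order.PFilter L :=
  Order.IsPFilter.toPFilter (F := {c | ∃ a ∈ F, f a ≤ c}) (Order.IsPFilter.of_def
    ⟨f ⊤, ⊤, F.top_mem, le_rfl⟩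
    (by
      rintro x ⟨a, ha, hax⟩ y ⟨b, hb, hby⟩
      exact ⟨f (a ⊓ b), ⟨a ⊓ b, F.inf_mem ha hb, le_rfl⟩,
        (hf inf_le_left).trans hax, (hf inf_le_right).trans hby⟩)
    (by
      rintro x y hxy ⟨a, ha, hax⟩
      exact ⟨a, ha, hax.trans hxy⟩))

/-- The ideal of all `c` below some `f a`, `a` in the ideal `I`, for monotone `f`. -/
def downIdeal (I : Order.Ideal L) (f : L → L) (hf : Monotone f) : Order.Ideal L where
  carrier := {c | ∃ a ∈ I, c ≤ f a}
  lower' := by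
    rintro x y hxy ⟨a, ha, hax⟩
    exact ⟨a, ha, hxy.trans hax⟩
  nonempty' := ⟨f ⊥, ⊥, I.bot_mem, le_rfl⟩
  directed' := by
    rintro x ⟨a, ha, hax⟩ y ⟨b, hb, hby⟩
    exact ⟨f (a ⊔ b), ⟨a ⊔ b, Order.Ideal.sup_mem ha hb, le_rfl⟩,
      hax.trans (hf le_sup_left), hby.trans (hf le_sup_right)⟩

/-- The ideal of all `c` below some `f a`, `a` in the filter `F`, for antitone `f`. -/
def negIdeal (F : Order.PFilter L) (f : L → L) (hf : Antitone f) : Order.Ideal L where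
  carrier := {c | ∃ a ∈ F, c ≤ f a}
  lower' := by
    rintro x y hxy ⟨a, ha, hax⟩
    exact ⟨a, ha, hxy.trans hax⟩
  nonempty' := ⟨f ⊤, ⊤, F.top_mem, le_rfl⟩
  directed' := by
    rintro x ⟨a, ha, hax⟩ y ⟨b, hb, hby⟩
    exact ⟨f (a ⊓ b), ⟨a ⊓ b, F.inf_mem ha hb, le_rfl⟩,
      hax.trans (hf inf_le_left), hby.trans (hf inf_le_right)⟩

variable {o : Ops L}

theorem Ops.IsFundModal.neg_antitone (h : o.IsFundModal) : Antitone o.neg := fun _ _ hab =>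
  (h.neg_adj _ _).1 (hab.trans ((h.neg_adj _ _).1 le_rfl))

theorem Ops.IsFundModal.box_monotone (h : o.IsFundModal) : Monotone o.box := fun a b hab => by
  have := h.box_inf a b
  rw [inf_eq_left.2 hab] at this
  exact inf_eq_left.1 this.symm

theorem Ops.IsFundModal.dia_monotone (h : o.IsFundModal) : Monotone o.dia := fun a b hab => by
  have := h.dia_sup a b
  rw [sup_eq_right.2 hab] at this
  exact sup_eq_right.1 this.symm

theorem Ops.IsFundModal.neg_bot (h : o.IsFundModal) : o.neg ⊥ = ⊤ :=
  top_le_iff.1 ((h.neg_adj _ _).1 bot_le)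

theorem Ops.IsFundModal.neg_top (h : o.IsFundModal) : o.neg ⊤ = ⊥ := by
  have := h.inf_neg ⊤
  rwa [top_inf_eq] at this

/-- The point with filter `F` and the least possible ideal. -/
def CanPoint.ofFilter (h : o.IsFundModal) (F : Order.PFilter L) (hF : ⊥ ∉ F) : CanPoint o where
  F := F
  I := negIdeal F o.neg h.neg_antitone
  proper := hF
  neg_mem a ha := ⟨a, ha, le_rfl⟩

/-- The point with ideal `I` and the least filter. -/
def CanPoint.ofIdeal (h : o.IsFundModal) (hL : (⊤ : L) ≠ ⊥) (I : Order.Ideal L) :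
    CanPoint o where
  F := Order.PFilter.principal ⊤
  I := I
  proper hb := hL (le_bot_iff.1 (Order.PFilter.mem_principal.1 hb))
  neg_mem a ha := by
    rw [top_le_iff.1 (Order.PFilter.mem_principal.1 ha), h.neg_top]
    exact I.bot_mem

/-- The point whose filter and ideal are the preimages of those of `x` under box and diamond. -/
def CanPoint.succ (h : o.IsFundModal) (x : CanPoint o) (hx : o.box ⊥ ∉ x.F) : CanPoint o where
  F := Order.IsPFilter.toPFilter (F := {a | o.box a ∈ x.F}) (Order.IsPFilter.of_def
    ⟨⊤, by rw [Set.mem_ofPred_eq, h.box_top]; exact x.F.top_mem⟩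
    (by
      intro a ha b hb
      refine ⟨a ⊓ b, ?_, inf_le_left, inf_le_right⟩
      rw [Set.mem_ofPred_eq, h.box_inf]
      exact x.F.inf_mem ha hb)
    (fun hab ha => x.F.mem_of_le (h.box_monotone hab) ha))
  I :=
    { carrier := {a | o.dia a ∈ x.I}
      lower' := fun _ _ hba ha => x.I.lower (h.dia_monotone hba) ha
      nonempty' := ⟨⊥, by rw [Set.mem_ofPred_eq, h.dia_bot]; exact x.I.bot_mem⟩
      directed' := by
        intro a ha b hb
        refine ⟨a ⊔ b, ?_, le_sup_left, le_sup_right⟩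
        rw [Set.mem_ofPred_eq, h.dia_sup]
        exact Order.Ideal.sup_mem ha hb }
  proper := hx
  neg_mem a ha := x.I.lower (h.dia_neg a) (x.neg_mem _ ha)

theorem CanPoint.top_ne_bot (x : CanPoint o) : (⊤ : L) ≠ ⊥ := fun h =>
  x.proper (h ▸ x.F.top_mem)

/-- The canonical frame of a fundamental modal lattice. -/
def canFrame (o : Ops L) (h : o.IsFundModal) : AUFMFrame.{u} where
  carrier := CanPoint o
  R x y := ∀ a, a ∈ x.I → a ∉ y.F
  M x y := (∀ a, o.box a ∈ x.F → a ∈ y.F) ∧ (∀ b, o.dia b ∈ x.I → b ∈ y.I)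
  coserial x := by
    refine ⟨CanPoint.ofFilter h x.F x.proper, ?_⟩
    rintro c ⟨a, ha, hca⟩ hc
    refine x.proper ?_
    rw [← h.inf_neg a]
    exact x.F.inf_mem ha (x.F.mem_of_le hca hc)
  pseudoRefl x := by
    refine ⟨CanPoint.ofFilter h x.F x.proper, ?_, fun z hz => hz⟩
    rintro c ⟨a, ha, hca⟩ hc
    refine x.proper ?_
    rw [← h.inf_neg a]
    exact x.F.inf_mem ha (x.F.mem_of_le hca hc)
  pseudoSymm x x' hxx' := by
    refine ⟨CanPoint.ofFilter h x'.F x'.proper, ?_, fun z hz => hz⟩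
    rintro c ⟨a, ha, hca⟩ hc
    exact hxx' a (x.I.lower ((h.neg_adj _ _).1 hca) (x.neg_mem _ hc)) ha
  cond_pos x y z hxy hzy := by
    refine ⟨CanPoint.ofIdeal h x.top_ne_bot (downIdeal z.I o.box h.box_monotone), ?_, ?_⟩
    · rintro c ⟨b, hb, hcb⟩ hc
      exact hzy b hb (hxy.1 b (x.F.mem_of_le hcb hc))
    · intro y' hy'
      have hb : ∀ b ∈ z.I, o.box b ∉ y'.F := fun b hb => hy' _ ⟨b, hb, le_rfl⟩
      exact ⟨y'.succ h (hb ⊥ z.I.bot_mem), ⟨fun a ha => ha, fun b hb => hb⟩, hb⟩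
  cond_neg x y z hxy hyz := by
    have hd : ∀ a ∈ z.F, o.dia a ∉ x.I := fun a ha hx => hyz a (hxy.2 a hx) ha
    refine ⟨CanPoint.ofFilter h (upFilter z.F o.dia h.dia_monotone) ?_, ?_, ?_⟩
    · rintro ⟨a, ha, hab⟩
      exact hd a ha (x.I.lower hab x.I.bot_mem)
    · rintro c hc ⟨a, ha, hac⟩
      exact hd a ha (x.I.lower hac hc)
    · intro y' hy'
      have hn : ∀ a ∈ z.F, o.dia a ∉ y'.I := fun a ha hy => hy' _ hy ⟨a, ha, le_rfl⟩
      refine ⟨y'.succ h (fun hb => ?_), ⟨fun a ha => ha, fun b hb => hb⟩,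
        fun a ha haz => hn a haz ha⟩
      have h1 := y'.I.lower (h.dia_neg ⊥) (y'.neg_mem _ hb)
      rw [h.neg_bot] at h1
      exact hn ⊤ z.F.top_mem h1

end Canonical

/-- The filter extension of an AUFM frame: the canonical frame of its positive algebra. -/
def AUFMFrame.filterExt (X : AUFMFrame.{u}) : AUFMFrame.{u} :=
  canFrame X.posOps X.posOps_isFundModal

/-! ### Morphisms and constructions on frames -/

/-- Fundamental morphisms. -/
structure IsFMorphism (X : FundFrame.{u}) (Y : FundFrame.{u}) (h : X.carrier → Y.carrier) :
    Prop where
  forth : ∀ x x', X.R x x' → Y.R (h x) (h x')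
  back_right : ∀ x y, Y.R (h x) y → ∃ x', X.R x x' ∧ PosRef Y.R (h x') y
  back_left_neg : ∀ x y, Y.R y (h x) → ∃ x', X.R x' x ∧ NegRef Y.R (h x') y
  back_left_pos : ∀ x y, Y.R y (h x) → ∃ x', X.R x' x ∧ PosRef Y.R (h x') y

/-- AUFM-morphisms. -/
structure IsAUFMMorphism (X : AUFMFrame.{u}) (Y : AUFMFrame.{u}) (h : X.carrier → Y.carrier) :
    Prop extends IsFMorphism X.toFundFrame Y.toFundFrame h where
  modal_forth : ∀ x x', X.M x x' → Y.M (h x) (h x')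
  modal_back : ∀ x y, Y.M (h x) y →
    ∃ x', X.M x x' ∧ PosRef Y.R y (h x') ∧ NegRef Y.R y (h x')

section MapProperties

variable (X Y : AUFMFrame.{u}) (h : X.carrier → Y.carrier)

/-- Density of a map between frames. -/
def IsDense : Prop :=
  ∀ y y', Y.R y' y → ∃ x, PosRef Y.R (h x) y ∧ Y.R y' (h x)

/-- Strong density: every point is positively equivalent to a point of the image. -/
def IsStronglyDense : Prop :=
  ∀ y, ∃ x, PosRef Y.R (h x) y ∧ PosRef Y.R y (h x)

/-- The defining property of embeddings. -/
def IsEmb : Prop :=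
  ∀ x x', Y.R (h x) (h x') → ∃ z, X.R x z ∧ PosRef X.R z x'

/-- The defining property of strong embeddings. -/
def IsStrongEmb : Prop :=
  ∀ x x', Y.R (h x) (h x') → X.R x x'

end MapProperties

/-- `X` is a modal subframe of `Y`. -/
def IsModalSubframe (X Y : AUFMFrame.{u}) : Prop :=
  ∃ h : X.carrier → Y.carrier, IsAUFMMorphism X Y h ∧ IsEmb X Y h

/-- `X` is a strong modal subframe of `Y`. -/
def IsStrongModalSubframe (X Y : AUFMFrame.{u}) : Prop :=
  ∃ h : X.carrier → Y.carrier, IsAUFMMorphism X Y h ∧ IsStrongEmb X Y h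

/-- `X` is a dense modal image of `Y`. -/
def IsDenseModalImage (X Y : AUFMFrame.{u}) : Prop :=
  ∃ g : Y.carrier → X.carrier, IsAUFMMorphism Y X g ∧ IsDense Y X g

/-- `X` is a strongly dense modal image of `Y`. -/
def IsStronglyDenseModalImage (X Y : AUFMFrame.{u}) : Prop :=
  ∃ g : Y.carrier → X.carrier, IsAUFMMorphism Y X g ∧ IsStronglyDense Y X g

/-- The disjoint union of a family of relations. -/
inductive SigmaRel {ι : Type u} {X : ι → Type u} (r : ∀ i, X i → X i → Prop) :
    (Σ i, X i) → (Σ i, X i) → Prop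
  | mk (i : ι) (x y : X i) (h : r i x y) : SigmaRel r ⟨i, x⟩ ⟨i, y⟩

theorem posRef_sigma {ι : Type u} {X : ι → Type u} (r : ∀ i, X i → X i → Prop) (i : ι)
    (x y : X i) (h : PosRef (r i) x y) : PosRef (SigmaRel r) ⟨i, x⟩ ⟨i, y⟩ := by
  rintro _ ⟨_, z, _, hz⟩
  exact .mk i z y (h z hz)

/-- The coproduct of a family of AUFM frames. -/
def coprod {ι : Type u} (X : ι → AUFMFrame.{u}) : AUFMFrame.{u} where
  carrier := Σ i, (X i).carrier
  R := SigmaRel fun i => (X i).R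
  M := SigmaRel fun i => (X i).M
  coserial := by
    rintro ⟨i, x⟩
    obtain ⟨x', hx'⟩ := (X i).coserial x
    exact ⟨⟨i, x'⟩, SigmaRel.mk (r := fun i => (X i).R) i x' x hx'⟩
  pseudoRefl := by
    rintro ⟨i, x⟩
    obtain ⟨y, hy, hyx⟩ := (X i).pseudoRefl x
    exact ⟨⟨i, y⟩, SigmaRel.mk (r := fun i => (X i).R) i y x hy, posRef_sigma (fun i => (X i).R) i y x hyx⟩
  pseudoSymm := by
    rintro _ _ ⟨i, x, x', hxx'⟩
    obtain ⟨y, hy, hyx⟩ := (X i).pseudoSymm x x' hxx'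
    exact ⟨⟨i, y⟩, SigmaRel.mk (r := fun i => (X i).R) i y x hy, posRef_sigma (fun i => (X i).R) i y x' hyx⟩
  cond_pos := by
    rintro _ _ _ ⟨i, x, y, hxy⟩ ⟨_, z, _, hzy⟩
    obtain ⟨x', hx', hall⟩ := (X i).cond_pos x y z hxy hzy
    refine ⟨⟨i, x'⟩, SigmaRel.mk (r := fun i => (X i).R) i x' x hx', ?_⟩
    rintro _ ⟨_, _, y', hy'⟩
    obtain ⟨z', hz', hzz'⟩ := hall y' hy'
    exact ⟨⟨i, z'⟩, SigmaRel.mk (r := fun i => (X i).M) i y' z' hz', SigmaRel.mk (r := fun i => (X i).R) i z z' hzz'⟩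
  cond_neg := by
    rintro _ _ _ ⟨i, x, y, hxy⟩ ⟨_, _, z, hyz⟩
    obtain ⟨x', hx', hall⟩ := (X i).cond_neg x y z hxy hyz
    refine ⟨⟨i, x'⟩, SigmaRel.mk (r := fun i => (X i).R) i x x' hx', ?_⟩
    rintro _ ⟨_, y', _, hy'⟩
    obtain ⟨z', hz', hzz'⟩ := hall y' hy'
    exact ⟨⟨i, z'⟩, SigmaRel.mk (r := fun i => (X i).M) i y' z' hz', SigmaRel.mk (r := fun i => (X i).R) i z' z hzz'⟩

/-! ### Closure conditions on classes of frames -/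

section Closure

variable (K : Set AUFMFrame.{u})

/-- Closure under filter extensions. -/
def ClosedFilterExt : Prop := ∀ X : AUFMFrame.{u}, X ∈ K → X.filterExt ∈ K

/-- Reflection of filter extensions. -/
def ReflectsFilterExt : Prop := ∀ X : AUFMFrame.{u}, X.filterExt ∈ K → X ∈ K

/-- Closure under modal subframes. -/
def ClosedModalSubframes : Prop :=
  ∀ X Y : AUFMFrame.{u}, Y ∈ K → IsModalSubframe X Y → X ∈ K

/-- Closure under strong modal subframes. -/
def ClosedStrongModalSubframes : Prop :=
  ∀ X Y : AUFMFrame.{u}, Y ∈ K → IsStrongModalSubframe X Y → X ∈ K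

/-- Closure under dense modal images. -/
def ClosedDenseModalImages : Prop :=
  ∀ X Y : AUFMFrame.{u}, Y ∈ K → IsDenseModalImage X Y → X ∈ K

/-- Closure under strongly dense modal images. -/
def ClosedStronglyDenseModalImages : Prop :=
  ∀ X Y : AUFMFrame.{u}, Y ∈ K → IsStronglyDenseModalImage X Y → X ∈ K

/-- Closure under coproducts (of all set-indexed families, the empty one included). -/
def ClosedCoproducts : Prop :=
  ∀ (ι : Type u) (X : ι → AUFMFrame.{u}), (∀ i, X i ∈ K) → coprod X ∈ K

end Closure

end FundLogic

/-! This is a Goldblatt–Thomason argument: a duality between AUFM frames and fundamental modal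
lattices reduces the statement to Birkhoff's variety theorem.

Preimage along an AUFM-morphism is a homomorphism of positive algebras in the opposite direction; it
is injective for dense morphisms and surjective for embeddings, and the positive algebra of a
coproduct is a product. Conversely, a homomorphism of algebras induces a morphism of canonical
frames in the opposite direction; injective homomorphisms give strongly dense morphisms and
surjective ones give strong embeddings. The two directions are linked by the fact that the positive
algebra of the canonical frame of an algebra is its `π`-canonical extension
(`isCanonicalExtension_canEmb`, `piExt_canEmb`), which is unique up to isomorphism
(`IsCanonicalExtension.isHom_orderIso`).

For 1 → 2, validity passes along these homomorphisms. Closure under filter extensions is canonicity,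
and reflection holds because an algebra embeds in its canonical extension. 2 → 3 holds because
strong embeddings and strongly dense maps are special cases of embeddings and dense maps.

For 3 → 1, take the logic of the class. Any algebra validating it is a homomorphic image of a
subalgebra of a product of positive algebras of frames in the class. On canonical frames this reads:
a strong modal subframe of a strongly dense modal image of the filter extension of a coproduct. So
its canonical frame is in the class (`canFrame_mem`). This gives canonicity and, with reflection of
filter extensions, that every frame validating the logic is in the class. -/

namespace FundLogic

/-! ### Homomorphisms and varieties -/

section Hom

variable {L : Type u} {L' : Type u} [Lattice L] [BoundedOrder L] [Lattice L'] [BoundedOrder L']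

/-- Homomorphisms of bounded lattices with operations. -/
structure Ops.IsHom (o : Ops L) (o' : Ops L') (f : BoundedLatticeHom L L') : Prop where
  map_neg : ∀ a, f (o.neg a) = o'.neg (f a)
  map_box : ∀ a, f (o.box a) = o'.box (f a)
  map_dia : ∀ a, f (o.dia a) = o'.dia (f a)

variable {o : Ops L} {o' : Ops L'} {f : BoundedLatticeHom L L'} {Λ : Form → Form → Prop}

theorem Ops.IsHom.map_eval (hf : o.IsHom o' f) (V : ℕ → L) (φ : Form) :
    f (o.eval V φ) = o'.eval (fun n => f (V n)) φ := by
  induction φ with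
  | var n => rfl
  | bot => exact map_bot f
  | top => exact map_top f
  | neg φ ih => simp only [Ops.eval, hf.map_neg, ih]
  | and φ ψ ih1 ih2 => simp only [Ops.eval, map_inf, ih1, ih2]
  | or φ ψ ih1 ih2 => simp only [Ops.eval, map_sup, ih1, ih2]
  | box φ ih => simp only [Ops.eval, hf.map_box, ih]
  | dia φ ih => simp only [Ops.eval, hf.map_dia, ih]

theorem le_iff_of_injective (hi : Function.Injective f) (a b : L) : f a ≤ f b ↔ a ≤ b := by
  rw [← inf_eq_left, ← map_inf, hi.eq_iff, inf_eq_left]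

theorem Ops.IsHom.isFundModal_of_injective (hf : o.IsHom o' f) (hi : Function.Injective f)
    (h : o'.IsFundModal) : o.IsFundModal where
  neg_adj a b := by
    rw [← le_iff_of_injective hi, hf.map_neg, h.neg_adj, ← hf.map_neg, le_iff_of_injective hi]
  inf_neg a := hi (by rw [map_inf, hf.map_neg, h.inf_neg, map_bot])
  box_inf a b := hi (by simp only [map_inf, hf.map_box, h.box_inf])
  box_top := hi (by rw [hf.map_box, map_top, h.box_top])
  dia_sup a b := hi (by simp only [map_sup, hf.map_dia, h.dia_sup])
  dia_bot := hi (by rw [hf.map_dia, map_bot, h.dia_bot])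
  dia_neg a := by
    rw [← le_iff_of_injective hi, hf.map_neg, hf.map_dia, hf.map_neg, hf.map_box]
    exact h.dia_neg _

theorem Ops.IsHom.inVariety_of_injective (hf : o.IsHom o' f) (hi : Function.Injective f)
    (h : o'.InVariety Λ) : o.InVariety Λ := by
  refine ⟨hf.isFundModal_of_injective hi h.1, fun φ ψ hΛ V => ?_⟩
  rw [← le_iff_of_injective hi, hf.map_eval, hf.map_eval]
  exact h.2 φ ψ hΛ _

theorem Ops.IsHom.eval_le_of_surjective (hf : o.IsHom o' f) (hs : Function.Surjective f)
    {φ ψ : Form} (h : ∀ V : ℕ → L, o.eval V φ ≤ o.eval V ψ) (V : ℕ → L') :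
    o'.eval V φ ≤ o'.eval V ψ := by
  -- A section of `f` lifts the valuation to the domain.
  choose g hg using hs
  have := OrderHomClass.mono f (h fun n => g (V n))
  rw [hf.map_eval, hf.map_eval] at this
  simpa only [hg] using this

theorem Ops.eval_subst (o : Ops L) (V : ℕ → L) (σ : ℕ → Form) (φ : Form) :
    o.eval V (φ.subst σ) = o.eval (fun n => o.eval V (σ n)) φ := by
  induction φ <;> simp_all [Ops.eval, Form.subst]

end Hom

/-! ### Frames and their positive algebras -/

theorem AUFMFrame.eval_posOps (X : AUFMFrame.{u}) (V : ℕ → PosAlg X.toFundFrame) (φ : Form) :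
    (X.posOps.eval V φ).1 = X.val (fun n => (V n).1) φ := by
  induction φ with
  | var n => rfl
  | bot => rfl
  | top => rfl
  | neg φ ih => exact congrArg (pneg X.R) ih
  | and φ ψ ih1 ih2 => exact congrArg₂ (fun A B => A ∩ B) ih1 ih2
  | or φ ψ ih1 ih2 => exact congrArg₂ (fun A B => clo X.R (A ∪ B)) ih1 ih2
  | box φ ih => exact congrArg (boxOp X.M) ih
  | dia φ ih => exact congrArg (diaOp X.R X.M) ih

theorem AUFMFrame.conseq_iff (X : AUFMFrame.{u}) (φ ψ : Form) :
    X.Conseq φ ψ ↔ ∀ V : ℕ → PosAlg X.toFundFrame, X.posOps.eval V φ ≤ X.posOps.eval V ψ := by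
  constructor
  · intro h V
    have := h (fun n => (V n).1) fun n => (V n).2
    rw [← X.eval_posOps, ← X.eval_posOps] at this
    exact this
  · intro h V hV
    let W : ℕ → PosAlg X.toFundFrame := fun n => ⟨V n, hV n⟩
    have : (X.posOps.eval W φ).1 ⊆ (X.posOps.eval W ψ).1 := h W
    rwa [X.eval_posOps, X.eval_posOps] at this

theorem mem_Mod_iff (X : AUFMFrame.{u}) (Λ : Form → Form → Prop) :
    X ∈ Mod Λ ↔ X.posOps.InVariety Λ :=
  ⟨fun h => ⟨X.posOps_isFundModal, fun φ ψ hΛ => (X.conseq_iff φ ψ).1 (h φ ψ hΛ)⟩,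
    fun h φ ψ hΛ => (X.conseq_iff φ ψ).2 (h.2 φ ψ hΛ)⟩

/-- The logic of a class of frames. -/
def logicOf (K : Set AUFMFrame.{u}) (φ ψ : Form) : Prop := ∀ X ∈ K, X.Conseq φ ψ

theorem isSuperFundModalLogic_logicOf (K : Set AUFMFrame.{u}) :
    IsSuperFundModalLogic (logicOf K) := by
  have key : ∀ φ ψ : Form, logicOf K φ ψ ↔ ∀ X ∈ K, ∀ V : ℕ → PosAlg X.toFundFrame,
      X.posOps.eval V φ ≤ X.posOps.eval V ψ :=
    fun φ ψ => forall₂_congr fun X _ => X.conseq_iff φ ψ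
  -- Read algebraically, every rule becomes a law of fundamental modal lattices.
  constructor <;> simp only [key]
  · exact fun φ X _ V => le_rfl
  · exact fun φ ψ χ h1 h2 X hX V => (h1 X hX V).trans (h2 X hX V)
  · exact fun φ X _ V => bot_le
  · exact fun φ X _ V => le_top
  · exact fun X _ V => X.posOps_isFundModal.neg_bot.ge
  · exact fun φ ψ X _ V => inf_le_left
  · exact fun φ ψ X _ V => inf_le_right
  · exact fun χ φ ψ h1 h2 X hX V => le_inf (h1 X hX V) (h2 X hX V)
  · exact fun φ ψ X _ V => le_sup_left
  · exact fun φ ψ X _ V => le_sup_right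
  · exact fun φ ψ χ h1 h2 X hX V => sup_le (h1 X hX V) (h2 X hX V)
  · exact fun φ X _ V => (X.posOps_isFundModal.inf_neg _).le
  · exact fun φ X _ V => (X.posOps_isFundModal.neg_adj _ _).1 le_rfl
  · exact fun φ ψ h X hX V => X.posOps_isFundModal.neg_antitone (h X hX V)
  · exact fun φ ψ h X hX V => X.posOps_isFundModal.box_monotone (h X hX V)
  · exact fun φ ψ X _ V => (X.posOps_isFundModal.box_inf _ _).ge
  · exact fun X _ V => X.posOps_isFundModal.box_top.ge
  · exact fun φ ψ h X hX V => X.posOps_isFundModal.dia_monotone (h X hX V)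
  · exact fun φ ψ X _ V => (X.posOps_isFundModal.dia_sup _ _).le
  · exact fun X _ V => X.posOps_isFundModal.dia_bot.le
  · exact fun φ X _ V => X.posOps_isFundModal.dia_neg _
  · intro φ ψ σ h X hX V
    rw [Ops.eval_subst, Ops.eval_subst]
    exact h X hX _

/-! ### Preimages along morphisms -/

theorem PosRef.mem_clo {X : Type u} {R : X → X → Prop} {x y : X} (h : PosRef R x y) {A : Set X}
    (hy : y ∈ clo R A) : x ∈ clo R A := fun z hz => hy z (h z hz)

theorem PosAlg.mem_of_posRef {X : FundFrame.{u}} (A : PosAlg X) {x y : X.carrier}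
    (h : PosRef X.R x y) (hy : y ∈ A.1) : x ∈ A.1 := by
  rw [← A.clo_eq] at hy ⊢
  exact h.mem_clo hy

theorem NegRef.mem_nneg {X : Type u} {R : X → X → Prop} {x y : X} (h : NegRef R x y) {A : Set X}
    (hy : y ∈ nneg R A) : x ∈ nneg R A := fun z hz => hy z (h z hz)

section Preimage

variable {X Y : AUFMFrame.{u}} {h : X.carrier → Y.carrier}

theorem IsFMorphism.clo_preimage (hh : IsFMorphism X.toFundFrame Y.toFundFrame h)
    {A : Set Y.carrier} (hA : clo Y.R A = A) : clo X.R (h ⁻¹' A) = h ⁻¹' A := by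
  refine Set.Subset.antisymm (fun x hx => ?_) (subset_clo _ _)
  change h x ∈ A
  rw [← hA]
  intro y hy
  obtain ⟨x', hx', hn⟩ := hh.back_left_neg x y hy
  obtain ⟨z, hz, hzA⟩ := hx x' hx'
  exact ⟨h z, hn _ (hh.forth _ _ hz), hzA⟩

theorem IsFMorphism.nneg_preimage (hh : IsFMorphism X.toFundFrame Y.toFundFrame h)
    (A : PosAlg Y.toFundFrame) : nneg X.R (h ⁻¹' A.1) = h ⁻¹' nneg Y.R A.1 := by
  ext x
  constructor
  · intro hx y hy hyA
    obtain ⟨x', hx', hp⟩ := hh.back_right x y hy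
    exact hx x' hx' (A.mem_of_posRef hp hyA)
  · exact fun hx x' hx' => hx _ (hh.forth _ _ hx')

theorem IsFMorphism.pneg_preimage (hh : IsFMorphism X.toFundFrame Y.toFundFrame h)
    (A : PosAlg Y.toFundFrame) : pneg X.R (h ⁻¹' A.1) = h ⁻¹' pneg Y.R A.1 := by
  ext x
  constructor
  · intro hx y hy hyA
    obtain ⟨x', hx', hp⟩ := hh.back_left_pos x y hy
    exact hx x' hx' (A.mem_of_posRef hp hyA)
  · exact fun hx x' hx' => hx _ (hh.forth _ _ hx')

/-- Sets of the form `nneg R A` need not lie in the positive algebra, but negative refinement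
preserves them. Hence this variant uses `back_left_neg` where `pneg_preimage` uses `back_left_pos`.
It is needed because diamond passes through such sets. -/
theorem IsFMorphism.pneg_preimage_nneg (hh : IsFMorphism X.toFundFrame Y.toFundFrame h)
    (A : Set Y.carrier) : pneg X.R (h ⁻¹' nneg Y.R A) = h ⁻¹' pneg Y.R (nneg Y.R A) := by
  ext x
  constructor
  · intro hx y hy hyA
    obtain ⟨x', hx', hp⟩ := hh.back_left_neg x y hy
    exact hx x' hx' (hp.mem_nneg hyA)
  · exact fun hx x' hx' => hx _ (hh.forth _ _ hx')

theorem IsAUFMMorphism.box_preimage (hh : IsAUFMMorphism X Y h) (A : PosAlg Y.toFundFrame) :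
    boxOp X.M (h ⁻¹' A.1) = h ⁻¹' boxOp Y.M A.1 := by
  ext x
  constructor
  · intro hx y hy
    obtain ⟨x', hx', hp, _⟩ := hh.modal_back x y hy
    exact A.mem_of_posRef hp (hx x' hx')
  · exact fun hx x' hx' => hx _ (hh.modal_forth _ _ hx')

theorem IsAUFMMorphism.box_preimage_nneg (hh : IsAUFMMorphism X Y h) (A : Set Y.carrier) :
    boxOp X.M (h ⁻¹' nneg Y.R A) = h ⁻¹' boxOp Y.M (nneg Y.R A) := by
  ext x
  constructor
  · intro hx y hy
    obtain ⟨x', hx', _, hn⟩ := hh.modal_back x y hy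
    exact hn.mem_nneg (hx x' hx')
  · exact fun hx x' hx' => hx _ (hh.modal_forth _ _ hx')

/-- The homomorphism of positive algebras dual to a morphism of frames. -/
def IsAUFMMorphism.preimage (hh : IsAUFMMorphism X Y h) :
    BoundedLatticeHom (PosAlg Y.toFundFrame) (PosAlg X.toFundFrame) where
  toFun A := PosAlg.mk (h ⁻¹' A.1) (hh.clo_preimage A.clo_eq)
  map_sup' A B := by
    refine le_antisymm (fun x hx x' hx' => ?_) (sup_le ?_ ?_)
    · obtain ⟨y, hy, hyAB⟩ := hx (h x') (hh.forth _ _ hx')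
      obtain ⟨z, hz, hp⟩ := hh.back_right x' y hy
      exact ⟨z, hz, hyAB.imp (A.mem_of_posRef hp) (B.mem_of_posRef hp)⟩
    · exact fun x hx => (le_sup_left : A ≤ A ⊔ B) hx
    · exact fun x hx => (le_sup_right : B ≤ A ⊔ B) hx
  map_inf' A B := rfl
  map_top' := rfl
  map_bot' := rfl

theorem IsAUFMMorphism.isHom_preimage (hh : IsAUFMMorphism X Y h) :
    Y.posOps.IsHom X.posOps hh.preimage where
  map_neg A := Subtype.ext (hh.pneg_preimage A).symm
  map_box A := Subtype.ext (hh.box_preimage A).symm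
  map_dia A := by
    apply Subtype.ext
    change h ⁻¹' pneg Y.R (boxOp Y.M (nneg Y.R A.1)) =
      pneg X.R (boxOp X.M (nneg X.R (h ⁻¹' A.1)))
    -- The box of a set `nneg R A` is again in the range of `nneg`; rewriting it in that form lets
    -- the outer `pneg` commute with the preimage.
    rw [hh.nneg_preimage, hh.box_preimage_nneg, ← Y.nneg_pneg_boxOp_nneg A.1,
      hh.pneg_preimage_nneg]

/-- To see `y ∈ B` it suffices to find, below each `y'` open to `y`, a witness in `B`. Density
supplies one in the image of `h` that positively refines `y`, hence lies in `A`. -/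
theorem IsAUFMMorphism.preimage_injective (hh : IsAUFMMorphism X Y h) (hd : IsDense X Y h) :
    Function.Injective hh.preimage := by
  have key : ∀ A B, hh.preimage A ≤ hh.preimage B → A ≤ B := by
    intro A B hAB y hy
    rw [← B.clo_eq]
    intro y' hy'
    obtain ⟨x, hx, hxy⟩ := hd y y' hy'
    have hxA : x ∈ (hh.preimage A).1 := A.mem_of_posRef hx hy
    exact ⟨h x, hxy, hAB hxA⟩
  exact fun A B hAB => le_antisymm (key _ _ hAB.le) (key _ _ hAB.ge)

theorem IsAUFMMorphism.preimage_surjective (hh : IsAUFMMorphism X Y h) (he : IsEmb X Y h) :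
    Function.Surjective hh.preimage := by
  intro A
  -- The closure of the direct image is the natural candidate; the embedding condition pulls the
  -- witnesses for this closure back to `X`.
  refine ⟨PosAlg.mk (clo Y.R (h '' A.1)) (clo_clo _ _), le_antisymm (fun x hx => ?_) ?_⟩
  · rw [← A.clo_eq]
    intro x' hx'
    obtain ⟨_, hz, z, hzA, rfl⟩ := hx (h x') (hh.forth _ _ hx')
    obtain ⟨w, hw, hwz⟩ := he x' z hz
    exact ⟨w, hw, A.mem_of_posRef hwz hzA⟩
  · exact fun x hx => subset_clo _ _ ⟨x, hx, rfl⟩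

theorem IsStrongEmb.isEmb (he : IsStrongEmb X Y h) : IsEmb X Y h := fun x x' hx =>
  ⟨x', he x x' hx, fun _ hz => hz⟩

theorem IsStronglyDense.isDense (hd : IsStronglyDense X Y h) : IsDense X Y h := fun y y' hy =>
  let ⟨x, h1, h2⟩ := hd y
  ⟨x, h1, h2 y' hy⟩

end Preimage

theorem IsDenseModalImage.conseq {X Y : AUFMFrame.{u}} (h : IsDenseModalImage X Y) {φ ψ : Form}
    (hY : Y.Conseq φ ψ) : X.Conseq φ ψ := by
  obtain ⟨g, hg, hd⟩ := h
  rw [AUFMFrame.conseq_iff] at hY ⊢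
  intro V
  rw [← le_iff_of_injective (hg.preimage_injective hd), hg.isHom_preimage.map_eval,
    hg.isHom_preimage.map_eval]
  exact hY _

theorem IsModalSubframe.conseq {X Y : AUFMFrame.{u}} (h : IsModalSubframe X Y) {φ ψ : Form}
    (hY : Y.Conseq φ ψ) : X.Conseq φ ψ := by
  obtain ⟨g, hg, he⟩ := h
  rw [AUFMFrame.conseq_iff] at hY ⊢
  exact hg.isHom_preimage.eval_le_of_surjective (hg.preimage_surjective he) hY

/-! ### Coproducts -/

section Coprod

variable {ι : Type u} (X : ι → AUFMFrame.{u})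

theorem isAUFMMorphism_inj (i : ι) :
    IsAUFMMorphism (X i) (coprod X) (fun x => (⟨i, x⟩ : Σ i, (X i).carrier)) where
  forth x x' h := SigmaRel.mk (r := fun i => (X i).R) i x x' h
  back_right := by
    rintro x _ ⟨_, _, y, hy⟩
    exact ⟨y, hy, fun _ hz => hz⟩
  back_left_neg := by
    rintro x _ ⟨_, y, _, hy⟩
    exact ⟨y, hy, fun _ hz => hz⟩
  back_left_pos := by
    rintro x _ ⟨_, y, _, hy⟩
    exact ⟨y, hy, fun _ hz => hz⟩
  modal_forth x x' h := SigmaRel.mk (r := fun i => (X i).M) i x x' h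
  modal_back := by
    rintro x _ ⟨_, _, y, hy⟩
    exact ⟨y, hy, fun _ hz => hz, fun _ hz => hz⟩

/-- With `coprodMk`, this is all that is needed of the fact that the positive algebra of a coproduct
is the product of the positive algebras. -/
theorem PosAlg.le_coprod_iff {ι : Type u} (X : ι → AUFMFrame.{u})
    (A B : PosAlg (coprod X).toFundFrame) :
    A ≤ B ↔ ∀ i, (isAUFMMorphism_inj X i).preimage A ≤ (isAUFMMorphism_inj X i).preimage B :=
  ⟨fun h _ => OrderHomClass.mono _ h, fun h x hx => h x.1 (a := x.2) hx⟩

/-- The element of the positive algebra of a coproduct with given components. -/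
def PosAlg.coprodMk (A : ∀ i, PosAlg (X i).toFundFrame) : PosAlg (coprod X).toFundFrame :=
  PosAlg.mk {x : Σ i, (X i).carrier | x.2 ∈ (A x.1).1} (by
    refine Set.Subset.antisymm ?_ (subset_clo _ _)
    rintro ⟨i, x⟩ hx
    change x ∈ (A i).1
    rw [← (A i).clo_eq]
    intro y hy
    obtain ⟨_, ⟨_, _, z, hz⟩, hzA⟩ := hx ⟨i, y⟩ (SigmaRel.mk (r := fun i => (X i).R) i y x hy)
    exact ⟨z, hz, hzA⟩)

theorem conseq_coprod {φ ψ : Form} (h : ∀ i, (X i).Conseq φ ψ) : (coprod X).Conseq φ ψ := by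
  rw [AUFMFrame.conseq_iff]
  intro V
  refine (PosAlg.le_coprod_iff X _ _).2 fun i => ?_
  rw [(isAUFMMorphism_inj X i).isHom_preimage.map_eval,
    (isAUFMMorphism_inj X i).isHom_preimage.map_eval]
  exact ((X i).conseq_iff φ ψ).1 (h i) _

end Coprod

/-! ### The canonical frame as a functor -/

section Functor

variable {L : Type u} {L' : Type u} [Lattice L] [BoundedOrder L] [Lattice L'] [BoundedOrder L']

/-- The preimage of a filter under a homomorphism. -/
def comapFilter (f : BoundedLatticeHom L L') (F : Order.PFilter L') : Order.PFilter L :=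
  Order.IsPFilter.toPFilter (F := {a | f a ∈ F}) (Order.IsPFilter.of_def
    ⟨⊤, by rw [Set.mem_ofPred_eq, map_top]; exact F.top_mem⟩
    (by
      intro a ha b hb
      refine ⟨a ⊓ b, ?_, inf_le_left, inf_le_right⟩
      rw [Set.mem_ofPred_eq, map_inf]
      exact F.inf_mem ha hb)
    (fun hab ha => F.mem_of_le (OrderHomClass.mono f hab) ha))

theorem mem_comapFilter {f : BoundedLatticeHom L L'} {F : Order.PFilter L'} {a : L} :
    a ∈ comapFilter f F ↔ f a ∈ F := Iff.rfl

/-- The preimage of an ideal under a homomorphism. -/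
def comapIdeal (f : BoundedLatticeHom L L') (I : Order.Ideal L') : Order.Ideal L where
  carrier := {a | f a ∈ I}
  lower' := fun _ _ hba ha => I.lower (OrderHomClass.mono f hba) ha
  nonempty' := ⟨⊥, by rw [Set.mem_ofPred_eq, map_bot]; exact I.bot_mem⟩
  directed' := by
    intro a ha b hb
    refine ⟨a ⊔ b, ?_, le_sup_left, le_sup_right⟩
    rw [Set.mem_ofPred_eq, map_sup]
    exact Order.Ideal.sup_mem ha hb

theorem mem_comapIdeal {f : BoundedLatticeHom L L'} {I : Order.Ideal L'} {a : L} :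
    a ∈ comapIdeal f I ↔ f a ∈ I := Iff.rfl

/-- The filter generated by the image of a filter. -/
def mapFilter (f : BoundedLatticeHom L L') (F : Order.PFilter L) : Order.PFilter L' :=
  Order.IsPFilter.toPFilter (F := {c | ∃ a ∈ F, f a ≤ c}) (Order.IsPFilter.of_def
    ⟨f ⊤, ⊤, F.top_mem, le_rfl⟩
    (by
      rintro x ⟨a, ha, hax⟩ y ⟨b, hb, hby⟩
      exact ⟨f (a ⊓ b), ⟨a ⊓ b, F.inf_mem ha hb, le_rfl⟩,
        (OrderHomClass.mono f inf_le_left).trans hax,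
        (OrderHomClass.mono f inf_le_right).trans hby⟩)
    (by
      rintro x y hxy ⟨a, ha, hax⟩
      exact ⟨a, ha, hax.trans hxy⟩))

/-- The ideal generated by the image of an ideal. -/
def mapIdeal (f : BoundedLatticeHom L L') (I : Order.Ideal L) : Order.Ideal L' where
  carrier := {c | ∃ a ∈ I, c ≤ f a}
  lower' := by
    rintro x y hxy ⟨a, ha, hax⟩
    exact ⟨a, ha, hxy.trans hax⟩
  nonempty' := ⟨f ⊥, ⊥, I.bot_mem, le_rfl⟩
  directed' := by
    rintro x ⟨a, ha, hax⟩ y ⟨b, hb, hby⟩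
    exact ⟨f (a ⊔ b), ⟨a ⊔ b, Order.Ideal.sup_mem ha hb, le_rfl⟩,
      hax.trans (OrderHomClass.mono f le_sup_left), hby.trans (OrderHomClass.mono f le_sup_right)⟩

variable {o : Ops L} {o' : Ops L'} {f : BoundedLatticeHom L L'}

/-- The map of canonical points dual to a homomorphism. -/
def Ops.IsHom.comapPoint (hf : o.IsHom o' f) (x : CanPoint o') : CanPoint o where
  F := comapFilter f x.F
  I := comapIdeal f x.I
  proper hb := x.proper (by rwa [mem_comapFilter, map_bot] at hb)
  neg_mem a ha := by
    rw [mem_comapIdeal, hf.map_neg]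
    exact x.neg_mem _ ha

theorem posRef_canFrame {h : o.IsFundModal} {x y : CanPoint o} (hxy : ∀ a ∈ y.F, a ∈ x.F) :
    PosRef (canFrame o h).R x y := fun _ hz a ha hay => hz a ha (hxy a hay)

theorem negRef_canFrame {h : o.IsFundModal} {x y : CanPoint o} (hxy : ∀ a ∈ y.I, a ∈ x.I) :
    NegRef (canFrame o h).R x y := fun _ hz a ha => hz a (hxy a ha)

theorem CanPoint.M_succ (h : o.IsFundModal) (x : CanPoint o) (hx : o.box ⊥ ∉ x.F) :
    (canFrame o h).M x (x.succ h hx) := ⟨fun _ ha => ha, fun _ ha => ha⟩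

/-- Each back condition is met by pushing one half of the given point forward along `f` and making
the other half as small as possible. The modal one is met by the point `succ`, whose halves are the
preimages under box and diamond. -/
theorem Ops.IsHom.isAUFMMorphism (hf : o.IsHom o' f) (h : o.IsFundModal) (h' : o'.IsFundModal) :
    IsAUFMMorphism (canFrame o' h') (canFrame o h) hf.comapPoint where
  forth x x' hx a ha ha' := hx _ ha ha'
  back_right x y hxy := by
    have hd : ∀ c, c ∈ x.I → c ∉ mapFilter f y.F := by
      rintro c hc ⟨a, ha, hac⟩
      exact hxy a (x.I.lower hac hc) ha
    exact ⟨CanPoint.ofFilter h' (mapFilter f y.F) (hd ⊥ x.I.bot_mem), hd,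
      posRef_canFrame fun a ha => ⟨a, ha, le_rfl⟩⟩
  back_left_neg x y hxy := by
    refine ⟨CanPoint.ofIdeal h' x.top_ne_bot (mapIdeal f y.I), ?_,
      negRef_canFrame fun a ha => ⟨a, ha, le_rfl⟩⟩
    rintro c ⟨a, ha, hac⟩ hc
    exact hxy a ha (x.F.mem_of_le hac hc)
  back_left_pos x y hxy := by
    -- The ideal of `y` contains the negations of its filter, so openness to the image of `x` keeps
    -- these negations out of the filter of `x`.
    have hd : ∀ a ∈ y.F, o'.neg (f a) ∉ x.F := by
      intro a ha hn
      rw [← hf.map_neg] at hn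
      exact hxy _ (y.neg_mem a ha) hn
    refine ⟨CanPoint.ofFilter h' (mapFilter f y.F) ?_, ?_,
      posRef_canFrame fun a ha => ⟨a, ha, le_rfl⟩⟩
    · rintro ⟨a, ha, hab⟩
      refine hd a ha ?_
      rw [le_bot_iff.1 hab, h'.neg_bot]
      exact x.F.top_mem
    · rintro c ⟨b, ⟨a, ha, hab⟩, hcb⟩ hc
      exact hd a ha (x.F.mem_of_le (hcb.trans (h'.neg_antitone hab)) hc)
  modal_forth x x' hx := by
    refine ⟨fun a ha => hx.1 _ ?_, fun a ha => hx.2 _ ?_⟩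
    · rw [← hf.map_box]; exact ha
    · rw [← hf.map_dia]; exact ha
  modal_back x y hxy := by
    have hb : ∀ a, o'.box (f a) ∈ x.F → a ∈ y.F := fun a ha =>
      hxy.1 a (by rw [← hf.map_box] at ha; exact ha)
    have hx : o'.box ⊥ ∉ x.F := fun hx => y.proper (hb ⊥ (by rwa [map_bot]))
    exact ⟨x.succ h' hx, x.M_succ h' hx, posRef_canFrame fun a ha => hb a ha,
      negRef_canFrame fun a ha => hxy.2 a (by
        have ha : o'.dia (f a) ∈ x.I := ha
        rw [← hf.map_dia] at ha; exact ha)⟩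

/-- For injective `f`, the filter generated by the image of a filter pulls back to that filter.
Equality of filters suffices for positive equivalence, so the ideals need not match. -/
theorem Ops.IsHom.isStronglyDenseModalImage (hf : o.IsHom o' f) (hi : Function.Injective f)
    (h : o.IsFundModal) (h' : o'.IsFundModal) :
    IsStronglyDenseModalImage (canFrame o h) (canFrame o' h') := by
  refine ⟨_, hf.isAUFMMorphism h h', fun y => ?_⟩
  have hm : ∀ a, f a ∈ mapFilter f y.F ↔ a ∈ y.F := fun a =>
    ⟨fun ⟨b, hb, hba⟩ => y.F.mem_of_le ((le_iff_of_injective hi _ _).1 hba) hb,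
      fun ha => ⟨a, ha, le_rfl⟩⟩
  have hp : ⊥ ∉ mapFilter f y.F := by
    rw [← map_bot f, hm]
    exact y.proper
  exact ⟨CanPoint.ofFilter h' _ hp, posRef_canFrame fun a ha => (hm a).2 ha,
    posRef_canFrame fun a ha => (hm a).1 ha⟩

theorem Ops.IsHom.isStrongModalSubframe (hf : o.IsHom o' f) (hs : Function.Surjective f)
    (h : o.IsFundModal) (h' : o'.IsFundModal) :
    IsStrongModalSubframe (canFrame o' h') (canFrame o h) := by
  refine ⟨_, hf.isAUFMMorphism h h', fun x y hxy c hx hy => ?_⟩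
  obtain ⟨a, rfl⟩ := hs c
  exact hxy a hx hy

end Functor

/-! ### The positive algebra of the canonical frame -/

section Complete

variable {X : FundFrame.{u}}

instance : CompleteLattice (PosAlg X) :=
  { (inferInstance : Lattice (PosAlg X)), (inferInstance : BoundedOrder (PosAlg X)) with
    sSup := fun S => PosAlg.mk (clo X.R {x | ∃ A ∈ S, x ∈ A.1}) (clo_clo _ _)
    sInf := fun S => PosAlg.mk {x | ∀ A ∈ S, x ∈ A.1}
      (Set.Subset.antisymm (fun x hx A hA => by
        have hle : clo X.R {x | ∀ A ∈ S, x ∈ A.1} ⊆ clo X.R A.1 := clo_mono X.R fun y hy => hy A hA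
        rw [A.clo_eq] at hle
        exact hle hx) (subset_clo _ _))
    isLUB_sSup := fun S => by
      refine ⟨fun A hA x hx => subset_clo X.R _ ⟨A, hA, hx⟩, fun B hB => ?_⟩
      have hle : clo X.R {x | ∃ A ∈ S, x ∈ A.1} ⊆ clo X.R B.1 :=
        clo_mono X.R fun y ⟨A, hA, hy⟩ => hB hA hy
      rw [B.clo_eq] at hle
      exact hle
    isGLB_sInf := fun S =>
      ⟨fun A hA (x : X.carrier) (hx : ∀ A ∈ S, x ∈ A.1) => hx A hA,
        fun B hB (x : X.carrier) (hx : x ∈ B.1) A hA => hB hA hx⟩ }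

theorem PosAlg.mem_sInf {S : Set (PosAlg X)} {x : X.carrier} :
    x ∈ (sInf S).1 ↔ ∀ A ∈ S, x ∈ A.1 := Iff.rfl

theorem PosAlg.mem_iInf {ι : Sort*} {A : ι → PosAlg X} {x : X.carrier} :
    x ∈ (⨅ i, A i).1 ↔ ∀ i, x ∈ (A i).1 := by
  rw [iInf, PosAlg.mem_sInf, Set.forall_mem_range]

end Complete

/-! ### The canonical embedding and its density and compactness -/

section Canonical

variable {L : Type u} [Lattice L] [BoundedOrder L] {o : Ops L} (h : o.IsFundModal)

/-- The points whose filter meets the ideal `J`. -/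
def openSet (J : Order.Ideal L) : PosAlg (canFrame o h).toFundFrame :=
  PosAlg.mk {x : CanPoint o | ∃ a ∈ J, a ∈ x.F} (by
    refine Set.Subset.antisymm (fun (x : CanPoint o) hx => ?_) (subset_clo _ _)
    by_contra hn
    -- If `J` misses the filter of `x`, the point with ideal `J` and least filter is open to `x`,
    -- yet it is open only to points whose filter misses `J`.
    obtain ⟨z, hz, a, ha, haz⟩ := hx (CanPoint.ofIdeal h x.top_ne_bot J)
      fun a ha hax => hn ⟨a, ha, hax⟩
    exact hz a ha haz)

theorem mem_nneg_canFrame_iff (A : PosAlg (canFrame o h).toFundFrame) (x : CanPoint o) :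
    x ∈ nneg (canFrame o h).R A.1 ↔ A ≤ openSet h x.I := by
  constructor
  · intro hx (y : CanPoint o) hy
    by_contra hn
    exact hx y (fun a ha hay => hn ⟨a, ha, hay⟩) hy
  · intro hA y hy hyA
    obtain ⟨a, ha, hay⟩ := hA hyA
    exact hy a ha hay

/-- By `mem_nneg_canFrame_iff`, the equation `pneg (nneg A) = A` says that `A` is the meet of the
open sets above it. Every ideal occurs here because it is the ideal of some point. -/
theorem mem_iff_forall_openSet (A : PosAlg (canFrame o h).toFundFrame) (x : CanPoint o) :
    x ∈ A.1 ↔ ∀ J : Order.Ideal L, A ≤ openSet h J → x ∈ (openSet h J).1 := by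
  refine ⟨fun hx J hJ => hJ hx, fun hx => ?_⟩
  rw [← A.2]
  intro y hy hyA
  obtain ⟨a, ha, hax⟩ := hx y.I ((mem_nneg_canFrame_iff h A y).1 hyA)
  exact hy a ha hax

theorem mem_of_openSet_principal_le {a : L} {J : Order.Ideal L}
    (ha : openSet h (.principal a) ≤ openSet h J) : a ∈ J := by
  by_cases hb : a = ⊥
  · rw [hb]; exact J.bot_mem
  have hp : ⊥ ∉ Order.PFilter.principal a := fun hp => hb (le_bot_iff.1 hp)
  -- The test point is the principal filter of `a` with its least ideal; it exists since `a ≠ ⊥`.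
  obtain ⟨b, hb, hba⟩ := ha (a := CanPoint.ofFilter h (.principal a) hp)
    ⟨a, le_rfl, Order.PFilter.mem_principal.2 le_rfl⟩
  exact J.lower hba hb

/-- The embedding of a fundamental modal lattice in the positive algebra of its canonical frame. -/
def canEmb : BoundedLatticeHom L (PosAlg (canFrame o h).toFundFrame) where
  toFun a := openSet h (Order.Ideal.principal a)
  map_sup' a b := by
    refine le_antisymm ?_ (sup_le ?_ ?_)
    · intro (x : CanPoint o) hx
      refine (mem_iff_forall_openSet h _ x).2 fun J hJ => ?_
      obtain ⟨c, hc, hcx⟩ := hx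
      exact ⟨c, J.lower hc (Order.Ideal.sup_mem
        (mem_of_openSet_principal_le h (le_sup_left.trans hJ))
        (mem_of_openSet_principal_le h (le_sup_right.trans hJ))), hcx⟩
    · rintro x ⟨c, hc, hcx⟩
      exact ⟨c, le_trans (b := a) hc le_sup_left, hcx⟩
    · rintro x ⟨c, hc, hcx⟩
      exact ⟨c, le_trans (b := b) hc le_sup_right, hcx⟩
  map_inf' a b := by
    refine le_antisymm (le_inf ?_ ?_) ?_
    · rintro x ⟨c, hc, hcx⟩
      exact ⟨c, le_trans (b := a ⊓ b) hc inf_le_left, hcx⟩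
    · rintro x ⟨c, hc, hcx⟩
      exact ⟨c, le_trans (b := a ⊓ b) hc inf_le_right, hcx⟩
    · rintro (x : CanPoint o) ⟨⟨c, hc, hcx⟩, ⟨d, hd, hdx⟩⟩
      exact ⟨c ⊓ d, inf_le_inf (show c ≤ a from hc) (show d ≤ b from hd), x.F.inf_mem hcx hdx⟩
  map_top' := top_le_iff.1 fun (x : CanPoint o) _ => ⟨⊤, le_rfl, x.F.top_mem⟩
  map_bot' := le_bot_iff.1 fun (x : CanPoint o) ⟨_, hc, hcx⟩ => x.proper (x.F.mem_of_le hc hcx)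

theorem mem_canEmb {a : L} {x : CanPoint o} : x ∈ (canEmb h a).1 ↔ a ∈ x.F :=
  ⟨fun ⟨_, hc, hcx⟩ => x.F.mem_of_le hc hcx, fun ha => ⟨a, le_rfl, ha⟩⟩

theorem canEmb_injective : Function.Injective (canEmb h) := fun a b hab =>
  le_antisymm (mem_of_openSet_principal_le h (J := .principal b) hab.le)
    (mem_of_openSet_principal_le h (J := .principal a) hab.ge)

/-- The ideal generated by a set. -/
def idealGen (T : Set L) : Order.Ideal L where
  carrier := {c | ∃ T' : Finset L, (T' : Set L) ⊆ T ∧ c ≤ T'.sup id}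
  lower' := fun _ _ hab ⟨T', hT', ha⟩ => ⟨T', hT', hab.trans ha⟩
  nonempty' := ⟨⊥, ∅, by simp, bot_le⟩
  directed' := by
    classical
    rintro a ⟨S, hS, ha⟩ b ⟨T', hT', hb⟩
    refine ⟨a ⊔ b, ⟨S ∪ T', ?_, ?_⟩, le_sup_left, le_sup_right⟩
    · rw [Finset.coe_union]; exact Set.union_subset hS hT'
    · rw [Finset.sup_union]; exact sup_le_sup ha hb

/-- The filter generated by a set. -/
def filterGen (S : Set L) : Order.PFilter L :=
  Order.IsPFilter.toPFilter (F := {c | ∃ S' : Finset L, (S' : Set L) ⊆ S ∧ S'.inf id ≤ c})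
    (Order.IsPFilter.of_def ⟨⊤, ∅, by simp, le_top⟩
    (by
      classical
      rintro a ⟨S', hS', ha⟩ b ⟨T', hT', hb⟩
      refine ⟨a ⊓ b, ⟨S' ∪ T', ?_, ?_⟩, inf_le_left, inf_le_right⟩
      · rw [Finset.coe_union]; exact Set.union_subset hS' hT'
      · rw [Finset.inf_union]; exact inf_le_inf ha hb)
    (fun hab ⟨T', hT', ha⟩ => ⟨T', hT', ha.trans hab⟩))

theorem mem_iInf_canEmb {S : Set L} {x : CanPoint o} :
    x ∈ (⨅ a ∈ S, canEmb h a).1 ↔ ∀ a ∈ S, a ∈ x.F := by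
  refine (PosAlg.mem_iInf (X := (canFrame o h).toFundFrame)).trans (forall_congr' fun a => ?_)
  exact (PosAlg.mem_iInf (X := (canFrame o h).toFundFrame)).trans
    (forall_congr' fun _ => mem_canEmb h)

theorem iSup_canEmb_le_openSet {T : Set L} {J : Order.Ideal L} (hT : ∀ a ∈ T, a ∈ J) :
    ⨆ a ∈ T, canEmb h a ≤ openSet h J :=
  iSup₂_le fun a ha _ hx => ⟨a, hT a ha, (mem_canEmb h).1 hx⟩

theorem canEmb_finset_sup_le {T : Set L} {T' : Finset L} (hT : (T' : Set L) ⊆ T) :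
    canEmb h (T'.sup id) ≤ ⨆ a ∈ T, canEmb h a := by
  rw [map_finset_sup]
  exact Finset.sup_le fun a ha => le_iSup₂_of_le a (hT ha) le_rfl

theorem iSup_canEmb_ideal (J : Order.Ideal L) : ⨆ a ∈ J, canEmb h a = openSet h J := by
  refine le_antisymm (iSup_canEmb_le_openSet h (T := (J : Set L)) fun _ ha => ha) ?_
  rintro x ⟨a, ha, hax⟩
  exact (le_iSup₂_of_le (f := fun a (_ : a ∈ J) => canEmb h a) a ha le_rfl)
    ((mem_canEmb h).2 hax)

theorem iSup_canEmb (T : Set L) : ⨆ a ∈ T, canEmb h a = openSet h (idealGen T) := by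
  refine le_antisymm (iSup_canEmb_le_openSet h fun a ha => ⟨{a}, by simpa using ha, by simp⟩) ?_
  rintro x ⟨a, ⟨T', hT', haT⟩, hax⟩
  exact canEmb_finset_sup_le h hT' ((mem_canEmb h).2 (x.F.mem_of_le haT hax))

theorem mem_of_filter_le (A : PosAlg (canFrame o h).toFundFrame) {x y : CanPoint o}
    (hxy : ∀ a ∈ y.F, a ∈ x.F) (hy : y ∈ A.1) : x ∈ A.1 :=
  A.mem_of_posRef (posRef_canFrame hxy) hy

/-- Elements of the positive algebra are closed under enlarging the filter of a point, hence are
joins of the closed elements given by the filters of their points. They are meets of open sets by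
`mem_iff_forall_openSet`. Compactness is tested at the point whose filter is generated by `S`. -/
theorem isCanonicalExtension_canEmb : IsCanonicalExtension (canEmb h) where
  injective := canEmb_injective h
  join_meets A := by
    refine ⟨{J | ∃ x : CanPoint o, x ∈ A.1 ∧ J = (x.F : Set L)}, le_antisymm ?_ ?_⟩
    · intro (x : CanPoint o) hx
      exact (le_iSup₂_of_le (f := fun (J : Set L)
        (_ : J ∈ {J | ∃ x : CanPoint o, x ∈ A.1 ∧ J = (x.F : Set L)}) => ⨅ a ∈ J, canEmb h a)
        (x.F : Set L) ⟨x, hx, rfl⟩ le_rfl) ((mem_iInf_canEmb h).2 fun _ ha => ha)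
    · refine iSup₂_le ?_
      rintro _ ⟨x, hx, rfl⟩ (y : CanPoint o) hy
      exact mem_of_filter_le h A ((mem_iInf_canEmb h).1 hy) hx
  meet_joins A := by
    refine ⟨{T | ∃ J : Order.Ideal L, A ≤ openSet h J ∧ T = (J : Set L)}, le_antisymm ?_ ?_⟩
    · refine le_iInf₂ ?_
      rintro _ ⟨J, hJ, rfl⟩
      exact hJ.trans (iSup_canEmb_ideal h J).ge
    · intro (x : CanPoint o) hx
      refine (mem_iff_forall_openSet h A x).2 fun J hJ => ?_
      rw [← iSup_canEmb_ideal]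
      exact (iInf₂_le_of_le (f := fun (T : Set L)
        (_ : T ∈ {T | ∃ J : Order.Ideal L, A ≤ openSet h J ∧ T = (J : Set L)}) =>
        ⨆ a ∈ T, canEmb h a) (J : Set L) ⟨J, hJ, rfl⟩ le_rfl) hx
  compact S T hST := by
    rw [iSup_canEmb] at hST
    by_cases hp : ⊥ ∈ filterGen S
    -- There is no test point in this case, but a finite meet from `S` is already `⊥`.
    · obtain ⟨S', hS', hb⟩ := hp
      exact ⟨S', ∅, hS', by simp, hb⟩
    · obtain ⟨a, ⟨T', hT', haT⟩, S', hS', haS⟩ := hST (a := CanPoint.ofFilter h (filterGen S) hp)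
        ((mem_iInf_canEmb h).2 fun a ha => ⟨{a}, by simpa using ha, by simp⟩)
      exact ⟨S', T', hS', hT', haS.trans haT⟩

/-! ### The `π`-extended operations are the operations of the canonical frame -/

theorem iInf_canEmb_filter_le_iff (F : Order.PFilter L) (A : PosAlg (canFrame o h).toFundFrame) :
    ⨅ a ∈ F, canEmb h a ≤ A ↔ ∀ hp : ⊥ ∉ F, CanPoint.ofFilter h F hp ∈ A.1 := by
  constructor
  · exact fun hA hp => hA ((mem_iInf_canEmb h (S := (F : Set L))).2 fun _ ha => ha)
  · intro hA (x : CanPoint o) hx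
    have hx := (mem_iInf_canEmb h (S := (F : Set L))).1 hx
    exact mem_of_filter_le h A hx (hA fun hb => x.proper (hx _ hb))

/-- The join is contained in the open set of the ideal generated by the negations, and by
directedness membership there is witnessed by a single element of `F`. -/
theorem mem_iSup_neg_iff (F : Order.PFilter L) (x : CanPoint o) :
    x ∈ (⨆ a ∈ F, canEmb h (o.neg a)).1 ↔ ∃ a ∈ F, o.neg a ∈ x.F := by
  constructor
  · intro hx
    have hle : ⨆ a ∈ F, canEmb h (o.neg a) ≤ openSet h (negIdeal F o.neg h.neg_antitone) :=
      iSup₂_le fun a ha _ hx => ⟨o.neg a, ⟨a, ha, le_rfl⟩, (mem_canEmb h).1 hx⟩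
    obtain ⟨c, ⟨a, ha, hca⟩, hcx⟩ := hle hx
    exact ⟨a, ha, x.F.mem_of_le hca hcx⟩
  · rintro ⟨a, ha, hax⟩
    exact (le_iSup₂_of_le (f := fun a (_ : a ∈ F) => canEmb h (o.neg a)) a ha le_rfl)
      ((mem_canEmb h).2 hax)

theorem mem_iSup_mono_iff {f : L → L} (hf : Monotone f) (J : Order.Ideal L) (x : CanPoint o) :
    x ∈ (⨆ a ∈ J, canEmb h (f a)).1 ↔ ∃ a ∈ J, f a ∈ x.F := by
  constructor
  · intro hx
    have hle : ⨆ a ∈ J, canEmb h (f a) ≤ openSet h (downIdeal J f hf) :=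
      iSup₂_le fun a ha _ hx => ⟨f a, ⟨a, ha, le_rfl⟩, (mem_canEmb h).1 hx⟩
    obtain ⟨c, ⟨a, ha, hca⟩, hcx⟩ := hle hx
    exact ⟨a, ha, x.F.mem_of_le hca hcx⟩
  · rintro ⟨a, ha, hax⟩
    exact (le_iSup₂_of_le (f := fun a (_ : a ∈ J) => canEmb h (f a)) a ha le_rfl)
      ((mem_canEmb h).2 hax)

theorem mem_piAnti_neg_iff (A : PosAlg (canFrame o h).toFundFrame) (x : CanPoint o) :
    x ∈ (piAnti (canEmb h) o.neg A).1 ↔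
      ∀ F : Order.PFilter L, (∀ hp : ⊥ ∉ F, CanPoint.ofFilter h F hp ∈ A.1) →
        ∃ a ∈ F, o.neg a ∈ x.F := by
  constructor
  · intro hx F hF
    exact (mem_iSup_neg_iff h F x).1 (hx _ ⟨F, (iInf_canEmb_filter_le_iff h F A).2 hF, rfl⟩)
  · rintro hx _ ⟨F, hF, rfl⟩
    exact (mem_iSup_neg_iff h F x).2 (hx F ((iInf_canEmb_filter_le_iff h F A).1 hF))

theorem mem_piMono_iff {f : L → L} (hf : Monotone f) (A : PosAlg (canFrame o h).toFundFrame)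
    (x : CanPoint o) :
    x ∈ (piMono (canEmb h) f A).1 ↔
      ∀ J : Order.Ideal L, A ≤ openSet h J → ∃ a ∈ J, f a ∈ x.F := by
  constructor
  · intro hx J hJ
    exact (mem_iSup_mono_iff h hf J x).1 (hx _ ⟨J, hJ.trans (iSup_canEmb_ideal h J).ge, rfl⟩)
  · rintro hx _ ⟨J, hJ, rfl⟩
    exact (mem_iSup_mono_iff h hf J x).2 (hx J (hJ.trans (iSup_canEmb_ideal h J).le))

theorem canEmb_eq_piMono {f : L → L} (hf : Monotone f) (a : L) :
    canEmb h (f a) = piMono (canEmb h) f (canEmb h a) := by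
  refine Subtype.ext (Set.ext fun (x : CanPoint o) => (mem_canEmb h).trans
    (Iff.trans ⟨?_, ?_⟩ (mem_piMono_iff h hf _ x).symm))
  · exact fun hx J hJ => ⟨a, mem_of_openSet_principal_le h hJ, hx⟩
  · intro hx
    obtain ⟨b, hb, hbx⟩ := hx (.principal a) le_rfl
    exact x.F.mem_of_le (hf hb) hbx

theorem piExt_neg (A : PosAlg (canFrame o h).toFundFrame) :
    piAnti (canEmb h) o.neg A = (canFrame o h).posOps.neg A := by
  refine Subtype.ext (Set.ext fun (x : CanPoint o) => (mem_piAnti_neg_iff h A x).trans ⟨?_, ?_⟩)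
  · intro hx (y : CanPoint o) hy hyA
    -- The filter of `y` itself is tested: the negation obtained lies in the ideal of `y` and in the
    -- filter of `x`, against openness of `y` to `x`.
    obtain ⟨a, ha, hax⟩ := hx y.F fun hp =>
      mem_of_filter_le h A (x := CanPoint.ofFilter h y.F hp) (y := y) (fun _ ha => ha) hyA
    exact hy _ (y.neg_mem a ha) hax
  · intro hx F hF
    by_cases hp : ⊥ ∈ F
    · exact ⟨⊥, hp, by rw [h.neg_bot]; exact x.F.top_mem⟩
    by_contra! hn
    refine hx (CanPoint.ofFilter h F hp) ?_ (hF hp)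
    rintro c ⟨a, ha, hca⟩ hcx
    exact hn a ha (x.F.mem_of_le hca hcx)

theorem piExt_box (A : PosAlg (canFrame o h).toFundFrame) :
    piMono (canEmb h) o.box A = (canFrame o h).posOps.box A := by
  refine Subtype.ext (Set.ext fun (x : CanPoint o) =>
    (mem_piMono_iff h h.box_monotone A x).trans ⟨?_, ?_⟩)
  · intro hx (y : CanPoint o) hy
    refine (mem_iff_forall_openSet h A y).2 fun J hJ => ?_
    obtain ⟨a, ha, hax⟩ := hx J hJ
    exact ⟨a, ha, hy.1 a hax⟩
  · intro hx J hJ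
    -- If `□⊥` is in the filter then `⊥` serves for every ideal; otherwise `succ` is the successor
    -- with the least filter, and testing it suffices.
    by_cases hb : o.box ⊥ ∈ x.F
    · exact ⟨⊥, J.bot_mem, hb⟩
    · exact hJ (hx (x.succ h hb) (x.M_succ h hb))

theorem mem_box_nneg_iff (A : PosAlg (canFrame o h).toFundFrame) (x : CanPoint o) :
    x ∈ boxOp (canFrame o h).M (nneg (canFrame o h).R A.1) ↔
      ∀ y : CanPoint o, y ∈ A.1 → ∃ a ∈ y.F, o.dia a ∈ x.I := by
  constructor
  · intro hx y hy
    by_cases hb : o.box ⊥ ∈ x.F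
    -- Here `x` has no successor; the law `◇¬⊥ ≤ ¬□⊥` puts `◇⊤` into its ideal.
    · refine ⟨⊤, y.F.top_mem, ?_⟩
      rw [← h.neg_bot]
      exact x.I.lower (h.dia_neg ⊥) (x.neg_mem _ hb)
    · obtain ⟨a, ha, hay⟩ := (mem_nneg_canFrame_iff h A _).1 (hx _ (x.M_succ h hb)) hy
      exact ⟨a, hay, ha⟩
  · intro hx (y : CanPoint o) hy
    refine (mem_nneg_canFrame_iff h A y).2 fun (z : CanPoint o) hz => ?_
    obtain ⟨a, ha, hax⟩ := hx z hz
    exact ⟨a, hy.2 a hax, ha⟩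

theorem piExt_dia (A : PosAlg (canFrame o h).toFundFrame) :
    piMono (canEmb h) o.dia A = (canFrame o h).posOps.dia A := by
  refine Subtype.ext (Set.ext fun (x : CanPoint o) =>
    (mem_piMono_iff h h.dia_monotone A x).trans ⟨?_, ?_⟩)
  · intro hx (y : CanPoint o) hy hyA
    have hyA := (mem_box_nneg_iff h A y).1 hyA
    -- This is the ideal of `succ`, formed directly because `y` may contain `□⊥` and then has no
    -- `succ`.
    let J : Order.Ideal L :=
      { carrier := {a | o.dia a ∈ y.I}
        lower' := fun _ _ hba ha => y.I.lower (h.dia_monotone hba) ha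
        nonempty' := ⟨⊥, by rw [Set.mem_ofPred_eq, h.dia_bot]; exact y.I.bot_mem⟩
        directed' := by
          intro a ha b hb
          refine ⟨a ⊔ b, ?_, le_sup_left, le_sup_right⟩
          rw [Set.mem_ofPred_eq, h.dia_sup]
          exact Order.Ideal.sup_mem ha hb }
    obtain ⟨a, ha, hax⟩ := hx J fun (z : CanPoint o) hz => by
      obtain ⟨a, ha, hay⟩ := hyA z hz
      exact ⟨a, hay, ha⟩
    exact hy _ ha hax
  · intro hx J hJ
    by_contra! hn
    refine hx (CanPoint.ofIdeal h x.top_ne_bot (downIdeal J o.dia h.dia_monotone)) ?_ ?_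
    · rintro c ⟨a, ha, hca⟩ hcx
      exact hn a ha (x.F.mem_of_le hca hcx)
    · refine (mem_box_nneg_iff h A _).2 fun y hy => ?_
      obtain ⟨a, ha, hay⟩ := hJ hy
      exact ⟨a, hay, a, ha, le_rfl⟩

theorem piExt_canEmb : o.piExt (canEmb h) = (canFrame o h).posOps := by
  have h1 : (o.piExt (canEmb h)).neg = (canFrame o h).posOps.neg := funext (piExt_neg h)
  have h2 : (o.piExt (canEmb h)).box = (canFrame o h).posOps.box := funext (piExt_box h)
  have h3 : (o.piExt (canEmb h)).dia = (canFrame o h).posOps.dia := funext (piExt_dia h)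
  cases hp : o.piExt (canEmb h)
  cases hq : (canFrame o h).posOps
  simp_all

/-- The `π`-extensions restrict to the original operations on `L`: the principal filter or ideal of
`a` is the extremal one in the defining meet. -/
theorem isHom_canEmb : o.IsHom (canFrame o h).posOps (canEmb h) where
  map_neg a := by
    rw [← piExt_neg]
    refine Subtype.ext (Set.ext fun (x : CanPoint o) => (mem_canEmb h).trans
      (Iff.trans ⟨?_, ?_⟩ (mem_piAnti_neg_iff h _ x).symm))
    · intro hx F hF
      by_cases hp : ⊥ ∈ F
      · exact ⟨⊥, hp, by rw [h.neg_bot]; exact x.F.top_mem⟩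
      · exact ⟨a, (mem_canEmb h).1 (hF hp), hx⟩
    · intro hx
      obtain ⟨b, hb, hbx⟩ := hx (.principal a) fun hp =>
        (mem_canEmb h).2 (Order.PFilter.mem_principal.2 le_rfl)
      exact x.F.mem_of_le (h.neg_antitone (Order.PFilter.mem_principal.1 hb)) hbx
  map_box a := by
    rw [← piExt_box]
    exact canEmb_eq_piMono h h.box_monotone a
  map_dia a := by
    rw [← piExt_dia]
    exact canEmb_eq_piMono h h.dia_monotone a

end Canonical

/-! ### Uniqueness of canonical extensions -/

section Uniqueness

variable {L C D : Type u} [Lattice L] [BoundedOrder L] [CompleteLattice C] [CompleteLattice D]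
  {e : BoundedLatticeHom L C} {e' : BoundedLatticeHom L D}

/-- The order between closed and open elements is decided inside `L`. Together with the two density
conditions this forces uniqueness of canonical extensions. -/
theorem IsCanonicalExtension.iInf_le_iSup_iff (he : IsCanonicalExtension e) (S T : Set L) :
    ⨅ a ∈ S, e a ≤ ⨆ b ∈ T, e b ↔
      ∃ S' T' : Finset L, (S' : Set L) ⊆ S ∧ (T' : Set L) ⊆ T ∧ S'.inf id ≤ T'.sup id := by
  refine ⟨he.compact S T, ?_⟩
  rintro ⟨S', T', hS, hT, hST⟩
  calc ⨅ a ∈ S, e a ≤ e (S'.inf id) := by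
        rw [map_finset_inf]
        exact Finset.le_inf fun a ha => iInf₂_le_of_le a (hS ha) le_rfl
    _ ≤ e (T'.sup id) := OrderHomClass.mono e hST
    _ ≤ ⨆ b ∈ T, e b := by
        rw [map_finset_sup]
        exact Finset.sup_le fun a ha => le_iSup₂_of_le a (hT ha) le_rfl

theorem IsCanonicalExtension.le_of_forall_closed (he : IsCanonicalExtension e) {c d : C}
    (h : ∀ S : Set L, ⨅ a ∈ S, e a ≤ c → ⨅ a ∈ S, e a ≤ d) : c ≤ d := by
  obtain ⟨𝒮, rfl⟩ := he.join_meets c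
  exact iSup₂_le fun S hS => h S (le_iSup₂_of_le (f := fun S (_ : S ∈ 𝒮) => ⨅ a ∈ S, e a) S hS
    le_rfl)

theorem IsCanonicalExtension.le_of_forall_open (he : IsCanonicalExtension e) {c d : C}
    (h : ∀ T : Set L, d ≤ ⨆ a ∈ T, e a → c ≤ ⨆ a ∈ T, e a) : c ≤ d := by
  obtain ⟨𝒯, rfl⟩ := he.meet_joins d
  exact le_iInf₂ fun T hT => h T (iInf₂_le_of_le (f := fun T (_ : T ∈ 𝒯) => ⨆ a ∈ T, e a) T hT
    le_rfl)

/-- The canonical map between two completions: it preserves closed elements. -/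
def transfer (e : BoundedLatticeHom L C) (e' : BoundedLatticeHom L D) (c : C) : D :=
  ⨆ S ∈ {S : Set L | ⨅ a ∈ S, e a ≤ c}, ⨅ a ∈ S, e' a

theorem le_transfer {c : C} {S : Set L} (hS : ⨅ a ∈ S, e a ≤ c) :
    ⨅ a ∈ S, e' a ≤ transfer e e' c :=
  le_iSup₂_of_le (f := fun S (_ : S ∈ {S : Set L | ⨅ a ∈ S, e a ≤ c}) => ⨅ a ∈ S, e' a) S hS le_rfl

theorem transfer_mono (e : BoundedLatticeHom L C) (e' : BoundedLatticeHom L D) :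
    Monotone (transfer e e') := fun _ _ hcd =>
  iSup₂_le fun _ hS => le_transfer (le_trans hS hcd)

theorem transfer_le (he : IsCanonicalExtension e) (he' : IsCanonicalExtension e') {c : C}
    {T : Set L} (hT : c ≤ ⨆ a ∈ T, e a) : transfer e e' c ≤ ⨆ a ∈ T, e' a :=
  iSup₂_le fun S hS =>
    (he'.iInf_le_iSup_iff S T).2 ((he.iInf_le_iSup_iff S T).1 (le_trans hS hT))

/-- A closed element of one completion is compared with the open elements above `c`; these
comparisons are the same in both completions. -/
theorem closed_le_transfer_iff (he : IsCanonicalExtension e) (he' : IsCanonicalExtension e')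
    {c : C} {S : Set L} : ⨅ a ∈ S, e' a ≤ transfer e e' c ↔ ⨅ a ∈ S, e a ≤ c := by
  refine ⟨fun hS => he.le_of_forall_open fun T hT => ?_, le_transfer⟩
  exact (he.iInf_le_iSup_iff S T).2
    ((he'.iInf_le_iSup_iff S T).1 (hS.trans (transfer_le he he' hT)))

theorem transfer_transfer (he : IsCanonicalExtension e) (he' : IsCanonicalExtension e') (c : C) :
    transfer e' e (transfer e e' c) = c := by
  refine le_antisymm (he.le_of_forall_closed fun S hS => ?_)
    (he.le_of_forall_closed fun S hS => ?_)
  · exact (closed_le_transfer_iff he he').1 ((closed_le_transfer_iff he' he).1 hS)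
  · exact le_transfer (le_transfer hS)

/-- Two canonical extensions of the same lattice are isomorphic. -/
def IsCanonicalExtension.orderIso (he : IsCanonicalExtension e) (he' : IsCanonicalExtension e') :
    C ≃o D where
  toFun := transfer e e'
  invFun := transfer e' e
  left_inv := transfer_transfer he he'
  right_inv := transfer_transfer he' he
  map_rel_iff' {c d} := by
    refine ⟨fun h => ?_, fun h => transfer_mono e e' h⟩
    rw [← transfer_transfer he he' c, ← transfer_transfer he he' d]
    exact transfer_mono e' e h

theorem IsCanonicalExtension.orderIso_apply_emb (he : IsCanonicalExtension e)
    (he' : IsCanonicalExtension e') (a : L) : he.orderIso he' (e a) = e' a := by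
  apply le_antisymm
  · have := transfer_le he he' (c := e a) (T := {a}) (by simp)
    rwa [iSup_singleton] at this
  · have := le_transfer (e := e) (e' := e') (c := e a) (S := {a}) (by simp)
    rwa [iInf_singleton] at this

/-- The `π`-operations are defined from the order and the images of filters and ideals of `L` alone,
so any isomorphism fixing `L` respects them. -/
theorem IsCanonicalExtension.isHom_orderIso (he : IsCanonicalExtension e)
    (he' : IsCanonicalExtension e') (o : Ops L) :
    (o.piExt e).IsHom (o.piExt e') (he.orderIso he' : BoundedLatticeHom C D) := by
  have hiSup : ∀ (f : L → L) (S : Set L),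
      he.orderIso he' (⨆ a ∈ S, e (f a)) = ⨆ a ∈ S, e' (f a) := by
    intro f S
    simp only [map_iSup, he.orderIso_apply_emb he']
  have hanti : ∀ (f : L → L) (c : C),
      he.orderIso he' (piAnti e f c) = piAnti e' f (he.orderIso he' c) := by
    intro f c
    rw [piAnti, map_sInf]
    refine congrArg sInf (Set.ext fun d => ⟨?_, ?_⟩)
    · rintro ⟨_, ⟨F, hF, rfl⟩, rfl⟩
      exact ⟨F, le_transfer (S := (F : Set L)) hF, hiSup f F⟩
    · rintro ⟨F, hF, rfl⟩
      exact ⟨_, ⟨F, (closed_le_transfer_iff he he' (S := (F : Set L))).1 hF, rfl⟩, hiSup f F⟩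
  have hmono : ∀ (f : L → L) (c : C),
      he.orderIso he' (piMono e f c) = piMono e' f (he.orderIso he' c) := by
    intro f c
    rw [piMono, map_sInf]
    refine congrArg sInf (Set.ext fun d => ⟨?_, ?_⟩)
    · rintro ⟨_, ⟨I, hI, rfl⟩, rfl⟩
      exact ⟨I, transfer_le he he' (T := (I : Set L)) hI, hiSup f I⟩
    · rintro ⟨I, hI, rfl⟩
      refine ⟨_, ⟨I, ?_, rfl⟩, hiSup f I⟩
      rw [← (he.orderIso he').le_iff_le]
      exact hI.trans_eq (hiSup id I).symm
  exact ⟨hanti _, hmono _, hmono _⟩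

end Uniqueness

/-! ### Terms over an arbitrary set of variables -/

/-- Terms of the language of fundamental modal lattices over the variables `α`. -/
inductive Tm (α : Type u) : Type u
  | var (a : α) : Tm α
  | bot : Tm α
  | top : Tm α
  | neg (t : Tm α) : Tm α
  | and (s t : Tm α) : Tm α
  | or (s t : Tm α) : Tm α
  | box (t : Tm α) : Tm α
  | dia (t : Tm α) : Tm α

/-- The variables of a term. -/
def Tm.vars {α : Type u} : Tm α → List α
  | .var a => [a]
  | .bot => []
  | .top => []
  | .neg t => t.vars
  | .and s t => s.vars ++ t.vars
  | .or s t => s.vars ++ t.vars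
  | .box t => t.vars
  | .dia t => t.vars

/-- The formula obtained by replacing the variables of a term by letters. -/
def Tm.toForm {α : Type u} (r : α → ℕ) : Tm α → Form
  | .var a => .var (r a)
  | .bot => .bot
  | .top => .top
  | .neg t => .neg (t.toForm r)
  | .and s t => .and (s.toForm r) (t.toForm r)
  | .or s t => .or (s.toForm r) (t.toForm r)
  | .box t => .box (t.toForm r)
  | .dia t => .dia (t.toForm r)

section Terms

variable {α : Type u} {L : Type v} [Lattice L] [BoundedOrder L]

/-- The value of a term in a bounded lattice with operations. -/
def Ops.evalTm (o : Ops L) (V : α → L) : Tm α → L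
  | .var a => V a
  | .bot => ⊥
  | .top => ⊤
  | .neg t => o.neg (o.evalTm V t)
  | .and s t => o.evalTm V s ⊓ o.evalTm V t
  | .or s t => o.evalTm V s ⊔ o.evalTm V t
  | .box t => o.box (o.evalTm V t)
  | .dia t => o.dia (o.evalTm V t)

theorem Ops.eval_toForm (o : Ops L) (V : ℕ → L) (r : α → ℕ) (t : Tm α) :
    o.eval V (t.toForm r) = o.evalTm (fun a => V (r a)) t := by
  induction t <;> simp_all [Ops.eval, Ops.evalTm, Tm.toForm]

theorem Ops.evalTm_congr (o : Ops L) {V W : α → L} {t : Tm α} (h : ∀ a ∈ t.vars, V a = W a) :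
    o.evalTm V t = o.evalTm W t := by
  induction t with
  | var a => exact h a (by simp [Tm.vars])
  | bot => rfl
  | top => rfl
  | neg t ih => exact congrArg o.neg (ih h)
  | and s t ih1 ih2 =>
    exact congrArg₂ (· ⊓ ·) (ih1 fun a ha => h a (List.mem_append_left _ ha))
      (ih2 fun a ha => h a (List.mem_append_right _ ha))
  | or s t ih1 ih2 =>
    exact congrArg₂ (· ⊔ ·) (ih1 fun a ha => h a (List.mem_append_left _ ha))
      (ih2 fun a ha => h a (List.mem_append_right _ ha))
  | box t ih => exact congrArg o.box (ih h)
  | dia t ih => exact congrArg o.dia (ih h)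

/-- An inequality of terms that fails under `V` fails for a pair of formulas. -/
theorem Ops.exists_toForm_not_le (o : Ops L) {V : α → L} {s t : Tm α}
    (h : ¬ o.evalTm V s ≤ o.evalTm V t) :
    ∃ (r : α → ℕ) (W : ℕ → L), ¬ o.eval W (s.toForm r) ≤ o.eval W (t.toForm r) := by
  classical
  -- Only finitely many variables occur. Each is replaced by the letter numbered by its first
  -- position in `l`; the default `⊥` is never used for an occurring variable.
  let l := s.vars ++ t.vars
  have key : ∀ a ∈ l, (l.map V).getD (l.idxOf a) ⊥ = V a := by
    intro a ha
    have hlt := List.idxOf_lt_length_of_mem ha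
    simp [List.getD, hlt]
  refine ⟨fun a => l.idxOf a, fun n => (l.map V).getD n ⊥, ?_⟩
  rw [Ops.eval_toForm, Ops.eval_toForm,
    o.evalTm_congr fun a ha => key a (List.mem_append_left _ ha),
    o.evalTm_congr fun a ha => key a (List.mem_append_right _ ha)]
  exact h

end Terms

theorem Ops.IsHom.map_evalTm {α L L' : Type u} [Lattice L] [BoundedOrder L] [Lattice L']
    [BoundedOrder L'] {o : Ops L} {o' : Ops L'} {f : BoundedLatticeHom L L'} (hf : o.IsHom o' f)
    (V : α → L) (t : Tm α) : f (o.evalTm V t) = o'.evalTm (fun a => f (V a)) t := by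
  induction t with
  | var n => rfl
  | bot => exact map_bot f
  | top => exact map_top f
  | neg t ih => simp only [Ops.evalTm, hf.map_neg, ih]
  | and s t ih1 ih2 => simp only [Ops.evalTm, map_inf, ih1, ih2]
  | or s t ih1 ih2 => simp only [Ops.evalTm, map_sup, ih1, ih2]
  | box t ih => simp only [Ops.evalTm, hf.map_box, ih]
  | dia t ih => simp only [Ops.evalTm, hf.map_dia, ih]

/-! ### Generated subalgebras -/

section Generated

variable {α L : Type u} [Lattice L] [BoundedOrder L]

/-- The subalgebra generated by the values of `V`. -/
def Ops.Generated (o : Ops L) (V : α → L) : Type u := {a : L // ∃ t, a = o.evalTm V t}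

variable {o : Ops L} {V : α → L}

instance : PartialOrder (o.Generated V) := Subtype.partialOrder _

instance : Lattice (o.Generated V) where
  sup a b := ⟨a.1 ⊔ b.1, by
    obtain ⟨_, s, rfl⟩ := a
    obtain ⟨_, t, rfl⟩ := b
    exact ⟨.or s t, rfl⟩⟩
  inf a b := ⟨a.1 ⊓ b.1, by
    obtain ⟨_, s, rfl⟩ := a
    obtain ⟨_, t, rfl⟩ := b
    exact ⟨.and s t, rfl⟩⟩
  le_sup_left a b := (le_sup_left : a.1 ≤ a.1 ⊔ b.1)
  le_sup_right a b := (le_sup_right : b.1 ≤ a.1 ⊔ b.1)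
  sup_le a b c h1 h2 := (sup_le h1 h2 : a.1 ⊔ b.1 ≤ c.1)
  inf_le_left a b := (inf_le_left : a.1 ⊓ b.1 ≤ a.1)
  inf_le_right a b := (inf_le_right : a.1 ⊓ b.1 ≤ b.1)
  le_inf a b c h1 h2 := (le_inf h1 h2 : a.1 ≤ b.1 ⊓ c.1)

instance : BoundedOrder (o.Generated V) where
  top := ⟨⊤, .top, rfl⟩
  le_top a := (le_top : a.1 ≤ ⊤)
  bot := ⟨⊥, .bot, rfl⟩
  bot_le a := (bot_le : ⊥ ≤ a.1)

variable (o V) in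
/-- The operations of the generated subalgebra. -/
def Ops.generatedOps : Ops (o.Generated V) where
  neg a := ⟨o.neg a.1, by
    obtain ⟨_, t, rfl⟩ := a
    exact ⟨.neg t, rfl⟩⟩
  box a := ⟨o.box a.1, by
    obtain ⟨_, t, rfl⟩ := a
    exact ⟨.box t, rfl⟩⟩
  dia a := ⟨o.dia a.1, by
    obtain ⟨_, t, rfl⟩ := a
    exact ⟨.dia t, rfl⟩⟩

variable (o V) in
/-- The inclusion of the generated subalgebra. -/
def Ops.generatedIncl : BoundedLatticeHom (o.Generated V) L where
  toFun a := a.1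
  map_sup' _ _ := rfl
  map_inf' _ _ := rfl
  map_top' := rfl
  map_bot' := rfl

theorem Ops.isHom_generatedIncl : (o.generatedOps V).IsHom o (o.generatedIncl V) :=
  ⟨fun _ => rfl, fun _ => rfl, fun _ => rfl⟩

theorem Ops.generatedIncl_injective : Function.Injective (o.generatedIncl V) :=
  Subtype.val_injective

/-- If every inequality of terms that holds under `V` holds under `W`, the subalgebra generated by
`V` maps homomorphically onto the values of terms under `W`. -/
theorem Ops.exists_isHom_of_forall_le {L' : Type u} [Lattice L'] [BoundedOrder L'] {o' : Ops L'}
    {W : α → L'}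
    (h : ∀ s t, o.evalTm V s ≤ o.evalTm V t → o'.evalTm W s ≤ o'.evalTm W t) :
    ∃ f : BoundedLatticeHom (o.Generated V) L', (o.generatedOps V).IsHom o' f ∧
      ∀ a, ∃ b, f b = W a := by
  choose g hg using fun a : o.Generated V => a.2
  -- The value assigned to `a` does not depend on the term chosen to represent it.
  have key : ∀ (a : o.Generated V) (t : Tm α), a.1 = o.evalTm V t →
      o'.evalTm W (g a) = o'.evalTm W t := fun a t ht =>
    le_antisymm (h _ _ ((hg a).symm.trans ht).le) (h _ _ ((hg a).symm.trans ht).ge)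
  refine ⟨{ toFun := fun a => o'.evalTm W (g a)
            map_sup' := fun a b => key _ (.or (g a) (g b)) (congrArg₂ _ (hg a) (hg b))
            map_inf' := fun a b => key _ (.and (g a) (g b)) (congrArg₂ _ (hg a) (hg b))
            map_top' := key _ .top rfl
            map_bot' := key _ .bot rfl }, ⟨fun a => ?_, fun a => ?_, fun a => ?_⟩, fun a => ?_⟩
  · exact key _ (.neg (g a)) (congrArg o.neg (hg a))
  · exact key _ (.box (g a)) (congrArg o.box (hg a))
  · exact key _ (.dia (g a)) (congrArg o.dia (hg a))
  · exact ⟨⟨V a, .var a, rfl⟩, key _ (.var a) rfl⟩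

end Generated

/-! ### The main theorem -/

/-- An inequality failing in an algebra of the variety is not a consequence in the logic of `K`, so
some frame of `K` refutes it. Terms have the elements of `L` as variables, so that generation by all
of `L` is available. -/
theorem exists_frame_refuting {K : Set AUFMFrame.{u}} {L : Type u} [Lattice L] [BoundedOrder L]
    {o : Ops L} (ho : o.InVariety (logicOf K)) {s t : Tm L}
    (h : ¬ o.evalTm id s ≤ o.evalTm id t) :
    ∃ X ∈ K, ∃ V : L → PosAlg X.toFundFrame, ¬ X.posOps.evalTm V s ≤ X.posOps.evalTm V t := by
  obtain ⟨r, W, hW⟩ := o.exists_toForm_not_le h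
  have hn : ¬ logicOf K (s.toForm r) (t.toForm r) := fun hl => hW (ho.2 _ _ hl W)
  simp only [logicOf, AUFMFrame.conseq_iff, Ops.eval_toForm] at hn
  push Not at hn
  obtain ⟨X, hX, V, hV⟩ := hn
  exact ⟨X, hX, fun a => V (r a), hV⟩

/-- Canonical frames of algebras in the variety of the logic of `K` belong to `K`. -/
theorem canFrame_mem {K : Set AUFMFrame.{u}} (hfe : ClosedFilterExt K)
    (hsub : ClosedStrongModalSubframes K) (him : ClosedStronglyDenseModalImages K)
    (hco : ClosedCoproducts K) {L : Type u} [Lattice L] [BoundedOrder L] {o : Ops L}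
    (ho : o.InVariety (logicOf K)) : canFrame o ho.1 ∈ K := by
  -- One refuting frame is chosen for each inequality that fails in `L` under the identity
  -- valuation; `W` then combines the refuting valuations, so only inequalities true in `L` survive.
  let ι : Type u := {p : Tm L × Tm L // ¬ o.evalTm id p.1 ≤ o.evalTm id p.2}
  choose X hX V hV using fun p : ι => exists_frame_refuting ho p.2
  let Y := coprod X
  let W : L → PosAlg Y.toFundFrame := fun a => PosAlg.coprodMk X fun i => V i a
  have hle : ∀ s t, Y.posOps.evalTm W s ≤ Y.posOps.evalTm W t →
      o.evalTm id s ≤ o.evalTm id t := by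
    intro s t hst
    by_contra hn
    refine hV ⟨(s, t), hn⟩ ?_
    have := (PosAlg.le_coprod_iff X _ _).1 hst ⟨(s, t), hn⟩
    rwa [(isAUFMMorphism_inj X _).isHom_preimage.map_evalTm,
      (isAUFMMorphism_inj X _).isHom_preimage.map_evalTm] at this
  -- The subalgebra generated by `W` maps onto `L`, since every element of `L` is a variable.
  obtain ⟨f, hf, hfs⟩ := Ops.exists_isHom_of_forall_le hle
  have hincl := Ops.isHom_generatedIncl (o := Y.posOps) (V := W)
  have hB := hincl.isFundModal_of_injective Ops.generatedIncl_injective Y.posOps_isFundModal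
  have h1 : canFrame _ hB ∈ K := him _ _ (hfe Y (hco ι X hX))
    (hincl.isStronglyDenseModalImage Ops.generatedIncl_injective hB Y.posOps_isFundModal)
  exact hsub _ _ h1 (hf.isStrongModalSubframe hfs hB ho.1)

/-- The canonical frame lies in `K`, so one `π`-canonical extension validates the logic; uniqueness
carries this to all others. -/
theorem isCanonicalLogic_logicOf {K : Set AUFMFrame.{u}} (hfe : ClosedFilterExt K)
    (hsub : ClosedStrongModalSubframes K) (him : ClosedStronglyDenseModalImages K)
    (hco : ClosedCoproducts K) : IsCanonicalLogic.{u} (logicOf K) := by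
  intro L _ _ o ho C _ e he
  have hmem := canFrame_mem hfe hsub him hco ho
  have hvar : (canFrame o ho.1).posOps.InVariety (logicOf K) :=
    (mem_Mod_iff _ _).1 fun φ ψ hl => hl _ hmem
  rw [← piExt_canEmb] at hvar
  have hcan := isCanonicalExtension_canEmb ho.1
  exact (he.isHom_orderIso hcan o).inVariety_of_injective (he.orderIso hcan).injective hvar

/-- Canonicity is used only for closure under filter extensions. -/
theorem Mod_closed {Λ : Form → Form → Prop} (hΛ : IsCanonicalLogic.{u} Λ) :
    ClosedFilterExt (Mod.{u} Λ) ∧ ClosedModalSubframes (Mod.{u} Λ) ∧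
      ClosedDenseModalImages (Mod.{u} Λ) ∧ ClosedCoproducts (Mod.{u} Λ) ∧
        ReflectsFilterExt (Mod.{u} Λ) := by
  refine ⟨fun X hX => ?_, fun X Y hY hXY φ ψ hl => hXY.conseq (hY φ ψ hl),
    fun X Y hY hXY φ ψ hl => hXY.conseq (hY φ ψ hl),
    fun ι X hX φ ψ hl => conseq_coprod X fun i => hX i φ ψ hl, fun X hX => ?_⟩
  · rw [mem_Mod_iff] at hX ⊢
    have := hΛ _ X.posOps hX _ _ (isCanonicalExtension_canEmb X.posOps_isFundModal)
    rwa [piExt_canEmb] at this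
  · rw [mem_Mod_iff] at hX ⊢
    exact (isHom_canEmb X.posOps_isFundModal).inVariety_of_injective
      (canEmb_injective X.posOps_isFundModal) hX

end FundLogic

theorem mainTheorem5 (K : Set FundLogic.AUFMFrame.{u}) :
    List.TFAE [
      ∃ Λ : FundLogic.Form → FundLogic.Form → Prop,
        FundLogic.IsSuperFundModalLogic Λ ∧ FundLogic.IsCanonicalLogic.{u} Λ ∧
          K = FundLogic.Mod.{u} Λ,
      FundLogic.ClosedFilterExt K ∧ FundLogic.ClosedModalSubframes K ∧
        FundLogic.ClosedDenseModalImages K ∧ FundLogic.ClosedCoproducts K ∧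
          FundLogic.ReflectsFilterExt K,
      FundLogic.ClosedFilterExt K ∧ FundLogic.ClosedStrongModalSubframes K ∧
        FundLogic.ClosedStronglyDenseModalImages K ∧ FundLogic.ClosedCoproducts K ∧
          FundLogic.ReflectsFilterExt K] := by
  tfae_have 1 → 2
  | ⟨Λ, _, hcan, hK⟩ => by
    subst hK
    exact FundLogic.Mod_closed hcan
  tfae_have 2 → 3
  | ⟨hfe, hsub, him, hco, href⟩ =>
    ⟨hfe, fun X Y hY ⟨f, hf, he⟩ => hsub X Y hY ⟨f, hf, he.isEmb⟩,
      fun X Y hY ⟨g, hg, hd⟩ => him X Y hY ⟨g, hg, hd.isDense⟩, hco, href⟩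
  tfae_have 3 → 1
  | ⟨hfe, hsub, him, hco, href⟩ => by
    refine ⟨FundLogic.logicOf K, FundLogic.isSuperFundModalLogic_logicOf K,
      FundLogic.isCanonicalLogic_logicOf hfe hsub him hco,
      Set.Subset.antisymm (fun X hX φ ψ hl => hl X hX) fun X hX => href X ?_⟩
    -- By definition, the canonical frame of the positive algebra of `X` is the filter extension of
    -- `X`.
    exact FundLogic.canFrame_mem hfe hsub him hco ((FundLogic.mem_Mod_iff _ _).1 hX)
  tfae_finish
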